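/- Let $M$ be a smooth manifold (finite-dimensional, Hausdorff, second countable, without boundary) and $E\to M$ a smooth real vector bundle of finite rank, with space of smooth sections $\Gamma(E)$. **Gauge algebroid.** For $m\in M$ let $(\mathfrak D E)_m$ be the space of $\mathbb R$-linear operators $\mathfrak d:\Gamma(E)\to E_m$ together with a tangent vector $\alpha(\mathfrak d)\in T_mM$ (the anchor) such that $\mathfrak d(fu)=f(m)\,\mathfrak d(u)+\alpha(\mathfrak d)(f)\,u(m)$ for all $f\in C^\infty(M)$, $u\in\Gamma(E)$. It contains $\mathfrak{gl}(E_m)$ (with zero anchor) via $\Phi\mapsto(u\mapsto\Phi(u(m)))$. The bracket $[\cdot,\cdot]_{\mathfrak D}$ on $\Gamma(\mathfrak D E)$ is the commutator. **Jet bundle.** The first jet bundle of $E$ is identified with its description as the standard $E$-dual of $\mathfrak D E$: $$(\mathfrak J E)_m=\{\nu\in\mathrm{Hom}((\mathfrak D E)_m,E_m)\;:\;\nu(\Phi)=\Phi(\nu(\mathbf 1))\ \ \forall\,\Phi\in\mathfrak{gl}(E_m)\},$$ with the $E$-valued pairing $\langle\mu,\mathfrak d\rangle_E=\mu(\mathfrak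 d)$; the jet prolongation $\mathbb d:\Gamma(E)\to\Gamma(\mathfrak J E)$ is $\langle\mathbb d u,\mathfrak d\rangle_E=\mathfrak d u$. **Omni-Lie algebroid.** Let $\mathcal E=\mathfrak D E\oplus\mathfrak J E$, with the symmetric form $(\mathfrak d+\mu,\mathfrak r+\nu)_E=\tfrac12(\langle\nu,\mathfrak d\rangle_E+\langle\mu,\mathfrak r\rangle_E)$ and, on $\Gamma(\mathcal E)$, the Dorfman bracket $$\{\mathfrak d+\mu,\mathfrak r+\nu\}=[\mathfrak d,\mathfrak r]_{\mathfrak D}+\mathcal L_{\mathfrak d}\nu-\mathcal L_{\mathfrak r}\mu+\mathbb d\langle\mu,\mathfrak r\rangle_E,$$ where $\mathcal L_{\mathfrak d}\mu\in\Gamma(\mathfrak J E)$ is defined by $\langle\mathcal L_{\mathfrak d}\mu,\mathfrak d'\rangle_E=\mathfrak d\langle\mu,\mathfrak d'\rangle_E-\langle\mu,[\mathfrak d,\mathfrak d']_{\mathfrak D}\rangle_E$ for all $\mathfrak d'\in\Gamma(\mathfrak D E)$. A *Dirac structure* in $\mathcal E$ is a smooth subbundle $L\subset\mathcal E$ that is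 maximal isotropic for $(\cdot,\cdot)_E$ and whose space of sections $\Gamma(L)$ is closed under the Dorfman bracket. A smooth bundle map $\pi:\mathfrak J E\to\mathfrak D E$ over $\mathrm{id}_M$ has graph $L_\pi=\{(\pi(\mu),\mu):\mu\in\mathfrak J E\}$. A *Lie algebroid structure* on $E$ is a pair of a smooth bundle map $\rho_E:E\to TM$ over $\mathrm{id}_M$ and a real Lie bracket $[\cdot,\cdot]_E$ on $\Gamma(E)$ such that $[u,fv]_E=f[u,v]_E+(\rho_E(u)f)\,v$ for all $u,v\in\Gamma(E)$, $f\in C^\infty(M)$. **Theorem.** If $\mathrm{rank}(E)\ge 2$, there is a one-to-one correspondence between Lie algebroid structures on $E$ and Dirac structures in $\mathcal E=\mathfrak D E\oplus\mathfrak J E$ that are graphs $L_\pi$ of smooth bundle maps $\pi:\mathfrak J E\to\mathfrak D E$. Under it, $([\cdot,\cdot]_E,\rho_E)$ corresponds to the $L_\pi$ with $$\pi(\mathbb d u)=[u,\cdot\,]_E,\qquad \rho_E(u)=\alpha(\pi(\mathbb d u))\qquad\text{for all }u\in\Gamma(E).$$ -/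

import Mathlib

open Bundle VectorField
open scoped Manifold ContDiff Topology

noncomputable section

namespace OmniLie

section VectorFields

theorem contMDiff_mvfderiv_apply {B : Type*} [NormedAddCommGroup B] [NormedSpace ℝ B] {H : Type*}
    [TopologicalSpace H] {I : ModelWithCorners ℝ B H} {M : Type*} [TopologicalSpace M]
    [ChartedSpace H M] [IsManifold I ∞ M] {f : M → ℝ} {X : Π x : M, TangentSpace I x}
    (hf : ContMDiff I 𝓘(ℝ, ℝ) ∞ f)
    (hX : ContMDiff I I.tangent ∞ (fun x => (⟨x, X x⟩ : TangentBundle I M))) :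
    ContMDiff I 𝓘(ℝ, ℝ) ∞ (fun x => mvfderiv I f x (X x)) := by
  have h1 := (hf.contMDiff_tangentMap (m := ∞) (by simp)).comp hX
  exact (contMDiff_snd_tangentBundle_modelSpace ℝ 𝓘(ℝ, ℝ)).comp h1

theorem mvfderiv_chart {B : Type*} [NormedAddCommGroup B] [NormedSpace ℝ B] {H : Type*}
    [TopologicalSpace H] {I : ModelWithCorners ℝ B H} {M : Type*} [TopologicalSpace M]
    [ChartedSpace H M] [IsManifold I ∞ M] {g : M → ℝ} (hg : ContMDiff I 𝓘(ℝ, ℝ) ∞ g)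
    (x : M) {y : B} (hy : y ∈ (extChartAt I x).target)
    (v : TangentSpace I ((extChartAt I x).symm y)) :
    fderivWithin ℝ (g ∘ (extChartAt I x).symm) (Set.range I) y
      ((mfderivWithin 𝓘(ℝ, B) I (extChartAt I x).symm (Set.range I) y).inverse v) =
      mvfderiv I g ((extChartAt I x).symm y) v := by
  have : IsManifold I 1 M := IsManifold.of_le (n := ∞) (by simp)
  have hinv := isInvertible_mfderivWithin_extChartAt_symm (I := I) hy
  have hc := mfderiv_comp_mfderivWithin (I := 𝓘(ℝ, B)) (I' := I) (I'' := 𝓘(ℝ, ℝ)) (g := g)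
    (f := (extChartAt I x).symm) (s := Set.range I) y (hg.mdifferentiableAt (by simp))
    (mdifferentiableWithinAt_extChartAt_symm hy)
    ((I.uniqueMDiffOn) y (extChartAt_target_subset_range x hy))
  rw [← mfderivWithin_eq_fderivWithin, hc]
  obtain ⟨e, he⟩ := hinv
  rw [← he, ContinuousLinearMap.inverse_equiv]
  change (mfderiv I 𝓘(ℝ, ℝ) g _) (e (e.symm v)) = _
  rw [e.apply_symm_apply]
  rfl

theorem mvfderiv_chart_inverse {B : Type*} [NormedAddCommGroup B] [NormedSpace ℝ B] {H : Type*}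
    [TopologicalSpace H] {I : ModelWithCorners ℝ B H} {M : Type*} [TopologicalSpace M]
    [ChartedSpace H M] [IsManifold I ∞ M] {g : M → ℝ} (hg : ContMDiff I 𝓘(ℝ, ℝ) ∞ g)
    (x : M) (w : B) :
    mvfderiv I g x ((mfderiv I 𝓘(ℝ, B) (extChartAt I x) x).inverse w) =
    fderivWithin ℝ (g ∘ (extChartAt I x).symm) (Set.range I) (extChartAt I x x) w := by
  have : IsManifold I 1 M := IsManifold.of_le (n := ∞) (by simp)
  have hxt : extChartAt I x x ∈ (extChartAt I x).target := mem_extChartAt_target x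
  have hA : MDifferentiableWithinAt 𝓘(ℝ, B) 𝓘(ℝ, ℝ) (g ∘ (extChartAt I x).symm) (Set.range I)
      (extChartAt I x x) :=
    (hg.mdifferentiableAt (by simp)).comp_mdifferentiableWithinAt _
      (mdifferentiableWithinAt_extChartAt_symm hxt)
  have hB : MDifferentiableAt I 𝓘(ℝ, B) (extChartAt I x) x :=
    mdifferentiableAt_extChartAt (mem_chart_source H x)
  have hC := (hA.hasMFDerivWithinAt).comp x (hB.hasMFDerivAt.hasMFDerivWithinAt (s := Set.univ))
    (fun y _ => by simp [extChartAt])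
  have hD : g =ᶠ[𝓝 x] (g ∘ (extChartAt I x).symm) ∘ (extChartAt I x) := by
    filter_upwards [extChartAt_source_mem_nhds (I := I) x] with y hy
    simp only [Function.comp_apply, (extChartAt I x).left_inv hy]
  have hE := ((hasMFDerivWithinAt_univ.1 hC).congr_of_eventuallyEq hD).mfderiv
  obtain ⟨e, he⟩ := isInvertible_mfderiv_extChartAt (I := I) (mem_extChartAt_source (I := I) x)
  rw [← mfderivWithin_eq_fderivWithin]
  change mfderiv I 𝓘(ℝ, ℝ) g x _ = _
  rw [hE, ← he, ContinuousLinearMap.inverse_equiv]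
  exact congrArg (mfderivWithin 𝓘(ℝ, B) 𝓘(ℝ, ℝ) (g ∘ (extChartAt I x).symm) (Set.range I)
    (extChartAt I x x)) (e.apply_symm_apply w)

theorem mvfderiv_mlieBracket {B : Type*} [NormedAddCommGroup B] [NormedSpace ℝ B] [CompleteSpace B]
    {H : Type*}
    [TopologicalSpace H] {I : ModelWithCorners ℝ B H} {M : Type*} [TopologicalSpace M]
    [ChartedSpace H M] [IsManifold I ∞ M] {f : M → ℝ} {X Y : Π x : M, TangentSpace I x}
    (hf : ContMDiff I 𝓘(ℝ, ℝ) ∞ f)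
    (hX : ContMDiff I I.tangent ∞ (fun x => (⟨x, X x⟩ : TangentBundle I M)))
    (hY : ContMDiff I I.tangent ∞ (fun x => (⟨x, Y x⟩ : TangentBundle I M))) (x : M) :
    mvfderiv I f x (mlieBracket I X Y x) =
      mvfderiv I (fun y => mvfderiv I f y (Y y)) x (X x) -
        mvfderiv I (fun y => mvfderiv I f y (X y)) x (Y x) := by
  have : IsManifold I 1 M := IsManifold.of_le (n := ∞) (by simp)
  have : IsManifold I 2 M := IsManifold.of_le (n := ∞) (WithTop.coe_le_coe.2 le_top)
  set φ := extChartAt I x with hφ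
  have hxt : φ x ∈ φ.target := mem_extChartAt_target x
  have hxr : φ x ∈ Set.range I := extChartAt_target_subset_range x hxt
  have hx0 : φ.symm (φ x) = x := extChartAt_to_inv x
  -- pulled back fields
  set X' := mpullbackWithin 𝓘(ℝ, B) I φ.symm X (Set.range I) with hX'
  set Y' := mpullbackWithin 𝓘(ℝ, B) I φ.symm Y (Set.range I) with hY'
  have key : ∀ (Z : Π x : M, TangentSpace I x) {g : M → ℝ}, ContMDiff I 𝓘(ℝ, ℝ) ∞ g →
      ∀ y ∈ φ.target, fderivWithin ℝ (g ∘ φ.symm) (Set.range I) y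
        (mpullbackWithin 𝓘(ℝ, B) I φ.symm Z (Set.range I) y) =
        mvfderiv I g (φ.symm y) (Z (φ.symm y)) := by
    intro Z g hg y hy
    exact mvfderiv_chart hg x hy _
  have ev : ∀ᶠ y in 𝓝[Set.range I] (φ x), y ∈ φ.target := extChartAt_target_mem_nhdsWithin x
  have hdX : DifferentiableWithinAt ℝ X' (Set.range I) (φ x) := by
    have := ((hX.mdifferentiable (by simp)) x).mdifferentiableWithinAt (s := Set.univ)
    have h2 := this.differentiableWithinAt_mpullbackWithin_vectorField
    rwa [Set.preimage_univ, Set.univ_inter] at h2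
  have hdY : DifferentiableWithinAt ℝ Y' (Set.range I) (φ x) := by
    have := ((hY.mdifferentiable (by simp)) x).mdifferentiableWithinAt (s := Set.univ)
    have h2 := this.differentiableWithinAt_mpullbackWithin_vectorField
    rwa [Set.preimage_univ, Set.univ_inter] at h2
  have hfc : ContDiffWithinAt ℝ 2 (f ∘ φ.symm) (Set.range I) (φ x) := by
    have h1 : ContMDiffWithinAt 𝓘(ℝ, B) 𝓘(ℝ, ℝ) ∞ (f ∘ φ.symm) (Set.range I) (φ x) :=
      (hf.contMDiffAt).comp_contMDiffWithinAt _ (contMDiffWithinAt_extChartAt_symm_range x hxt)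
    exact h1.contDiffWithinAt.of_le (WithTop.coe_le_coe.2 le_top)
  have main := fderivWithin_apply_lieBracket (n := 2) (V := X') (W := Y') hfc (by simp)
    I.uniqueDiffOn (I.range_subset_closure_interior hxr) hxr hdY hdX
  have second : ∀ (Z Z' : Π x : M, TangentSpace I x),
      ContMDiff I I.tangent ∞ (fun x => (⟨x, Z x⟩ : TangentBundle I M)) →
      fderivWithin ℝ (fun y => fderivWithin ℝ (f ∘ φ.symm) (Set.range I) y
        (mpullbackWithin 𝓘(ℝ, B) I φ.symm Z (Set.range I) y)) (Set.range I) (φ x)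
        (mpullbackWithin 𝓘(ℝ, B) I φ.symm Z' (Set.range I) (φ x)) =
      mvfderiv I (fun y => mvfderiv I f y (Z y)) x (Z' x) := by
    intro Z Z' hZ
    have e1 : (fun y => fderivWithin ℝ (f ∘ φ.symm) (Set.range I) y
        (mpullbackWithin 𝓘(ℝ, B) I φ.symm Z (Set.range I) y)) =ᶠ[𝓝[Set.range I] (φ x)]
        (fun y => mvfderiv I f y (Z y)) ∘ φ.symm := by
      filter_upwards [ev] with y hy
      exact key Z hf y hy
    rw [e1.fderivWithin_eq (key Z hf _ hxt), key Z' (contMDiff_mvfderiv_apply hf hZ) _ hxt, hx0]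
  rw [second Y X hY, second X Y hX] at main
  rw [← main, ← mlieBracketWithin_univ, mlieBracketWithin_apply]
  rw [mvfderiv_chart_inverse hf x, Set.preimage_univ, Set.univ_inter]

end VectorFields

variable {B : Type*} [NormedAddCommGroup B] [NormedSpace ℝ B]
  {H : Type*} [TopologicalSpace H] (I : ModelWithCorners ℝ B H)
  {M : Type*} [TopologicalSpace M] [ChartedSpace H M]
  (F : Type*) [NormedAddCommGroup F] [NormedSpace ℝ F]
  (E : M → Type*) [TopologicalSpace (TotalSpace F E)]
  [∀ m, AddCommGroup (E m)] [∀ m, Module ℝ (E m)] [∀ m, TopologicalSpace (E m)]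
  [FiberBundle F E] [VectorBundle ℝ F E]

/-- `Γ(E)`, the smooth sections of `E`. -/
abbrev Sec := ContMDiffSection I F ∞ E

variable {I F E}

/-- The product `f u` of a smooth function and a smooth section. -/
def fmul (f : C^∞⟮I, M; ℝ⟯) (u : Sec I F E) : Sec I F E :=
  ⟨fun m => f m • u m, f.contMDiff.smul_section u.contMDiff⟩

variable (I F E)

/-- Evaluation of sections at a point, as a linear map `Γ(E) → E_m`. -/
def evalAt (m : M) : Sec I F E →ₗ[ℝ] E m where
  toFun u := u m
  map_add' _ _ := rfl
  map_smul' _ _ := rfl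

/-- The fibre `(𝔇E)_m` of the gauge Lie algebroid: pairs `(𝔡, x)` of an `ℝ`-linear operator
`𝔡 : Γ(E) → E_m` and a tangent vector `x ∈ T_m M` (the anchor of `𝔡`) such that
`𝔡(f u) = f(m) 𝔡(u) + x(f) u(m)`. -/
def Gauge (m : M) : Submodule ℝ ((Sec I F E →ₗ[ℝ] E m) × TangentSpace I m) where
  carrier := {δ | ∀ (f : C^∞⟮I, M; ℝ⟯) (u : Sec I F E),
    δ.1 (fmul f u) = f m • δ.1 u + mvfderiv I f m δ.2 • u m}
  zero_mem' f u := by simp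
  add_mem' {a b} ha hb f u := by
    simp only [Prod.fst_add, Prod.snd_add, LinearMap.add_apply, map_add, ha f u, hb f u]
    module
  smul_mem' c a ha f u := by
    simp only [Prod.smul_fst, Prod.smul_snd, LinearMap.smul_apply, map_smul, ha f u]
    module

variable {I F E}

/-- The operator `Γ(E) → E_m` underlying an element of `(𝔇E)_m`. -/
def gaugeOp {m : M} (δ : Gauge I F E m) : Sec I F E →ₗ[ℝ] E m := δ.1.1

/-- The anchor `α : (𝔇E)_m → T_m M`. -/
def gaugeAnchor {m : M} (δ : Gauge I F E m) : TangentSpace I m := δ.1.2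

/-- The inclusion `gl(E_m) → (𝔇E)_m`, `Φ ↦ (u ↦ Φ (u m))`, with anchor zero. -/
def gaugeOfEnd {m : M} (Φ : E m →ₗ[ℝ] E m) : Gauge I F E m :=
  ⟨(Φ ∘ₗ evalAt I F E m, 0), fun f u => by simp [evalAt, fmul]⟩

variable (I F E)

/-- The fibre `(𝔍E)_m` of the jet bundle, as the standard `E`-dual of `𝔇E`: linear maps
`ν : (𝔇E)_m → E_m` with `ν(Φ) = Φ(ν(1))` for all `Φ ∈ gl(E_m)`. The one-jet of a section `u`
at `m` is the map `𝔡 ↦ 𝔡 u`. -/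
def Jet (m : M) : Submodule ℝ (Gauge I F E m →ₗ[ℝ] E m) where
  carrier := {ν | ∀ Φ : E m →ₗ[ℝ] E m, ν (gaugeOfEnd Φ) = Φ (ν (gaugeOfEnd LinearMap.id))}
  zero_mem' Φ := by simp
  add_mem' {a b} ha hb Φ := by simp only [LinearMap.add_apply, map_add, ha Φ, hb Φ]
  smul_mem' c a ha Φ := by simp only [LinearMap.smul_apply, map_smul, ha Φ]

variable {I F E}

/-- The `E`-valued pairing `⟨μ, 𝔡⟩_E` between `(𝔍E)_m` and `(𝔇E)_m`. -/
def pairAt {m : M} (μ : Jet I F E m) (δ : Gauge I F E m) : E m := μ.1 δ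

variable (I F E)

/-- `(𝓔)_m = (𝔇E)_m ⊕ (𝔍E)_m`. -/
abbrev Omni (m : M) := Gauge I F E m × Jet I F E m

variable {I F E}

/-- The symmetric `E`-valued form
`(𝔡 + μ, 𝔯 + ν)_E = (⟨𝔡, ν⟩_E + ⟨𝔯, μ⟩_E) / 2` on `𝓔_m`. -/
def omniPairing {m : M} (X Y : Omni I F E m) : E m :=
  (1 / 2 : ℝ) • (pairAt Y.2 X.1 + pairAt X.2 Y.1)

variable [IsManifold I ∞ M]
variable (I F E)

/-- `Γ(𝔇E)`: the families `m ↦ 𝔡_m ∈ (𝔇E)_m` which are smooth, i.e. `m ↦ 𝔡_m u` is a smooth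
section of `E` for each `u ∈ Γ(E)` and `m ↦ α(𝔡_m)` is a smooth vector field. -/
def GaugeSec : Submodule ℝ (Π m : M, Gauge I F E m) where
  carrier := {d | (∀ u : Sec I F E,
      ContMDiff I (I.prod 𝓘(ℝ, F)) ∞ (fun m => (⟨m, gaugeOp (d m) u⟩ : TotalSpace F E))) ∧
    ContMDiff I I.tangent ∞ (fun m => (⟨m, gaugeAnchor (d m)⟩ : TangentBundle I M))}
  zero_mem' := ⟨fun _ => (0 : Sec I F E).contMDiff,
    (0 : ContMDiffSection I B ∞ (TangentSpace I : M → Type _)).contMDiff⟩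
  add_mem' ha hb := ⟨fun u => (ha.1 u).add_section (hb.1 u), ha.2.add_section hb.2⟩
  smul_mem' _ _ ha := ⟨fun u => (ha.1 u).const_smul_section, ha.2.const_smul_section⟩

/-- `Γ(𝔍E)`: the families `m ↦ μ_m ∈ (𝔍E)_m` which are smooth as sections of `Hom(𝔇E, E)`,
i.e. `m ↦ ⟨μ_m, 𝔡_m⟩_E` is a smooth section of `E` for each `𝔡 ∈ Γ(𝔇E)`. -/
def JetSec : Submodule ℝ (Π m : M, Jet I F E m) where
  carrier := {μ | ∀ d ∈ GaugeSec I F E,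
    ContMDiff I (I.prod 𝓘(ℝ, F)) ∞ (fun m => (⟨m, pairAt (μ m) (d m)⟩ : TotalSpace F E))}
  zero_mem' _ _ := (0 : Sec I F E).contMDiff
  add_mem' ha hb d hd := (ha d hd).add_section (hb d hd)
  smul_mem' _ _ ha d hd := (ha d hd).const_smul_section

/-- `Γ(𝓔) = Γ(𝔇E) ⊕ Γ(𝔍E)`. -/
abbrev OmniSec := GaugeSec I F E × JetSec I F E

variable {I F E}

/-- The value at `m` of a section of `𝓔`. -/
def omniAt (X : OmniSec I F E) (m : M) : Omni I F E m := (X.1.1 m, X.2.1 m)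

/-- The action of `𝔡 ∈ Γ(𝔇E)` on `Γ(E)`. -/
def act (d : GaugeSec I F E) : Sec I F E →ₗ[ℝ] Sec I F E where
  toFun u := ⟨fun m => gaugeOp (d.1 m) u, d.2.1 u⟩
  map_add' u v := ContMDiffSection.ext fun m => map_add (gaugeOp (d.1 m)) u v
  map_smul' c u := ContMDiffSection.ext fun m => map_smul (gaugeOp (d.1 m)) c u

/-- The pairing `⟨μ, 𝔡⟩_E ∈ Γ(E)` of sections. -/
def pair (μ : JetSec I F E) (d : GaugeSec I F E) : Sec I F E :=
  ⟨fun m => pairAt (μ.1 m) (d.1 m), μ.2 d.1 d.2⟩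

/-- The jet prolongation `𝕕 : Γ(E) → Γ(𝔍E)`, `⟨𝕕u, 𝔡⟩_E = 𝔡 u`. -/
def jet (u : Sec I F E) : JetSec I F E :=
  ⟨fun _ => ⟨{ toFun := fun δ => gaugeOp δ u
               map_add' := fun _ _ => rfl
               map_smul' := fun _ _ => rfl }, fun _ => rfl⟩,
    fun _ hd => hd.1 u⟩

theorem act_fmul (d : GaugeSec I F E) (f : C^∞⟮I, M; ℝ⟯) (u : Sec I F E) :
    act d (fmul f u) = fmul f (act d u) +
      fmul ⟨fun m => mvfderiv I f m (gaugeAnchor (d.1 m)),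
        contMDiff_mvfderiv_apply f.contMDiff d.2.2⟩ u :=
  ContMDiffSection.ext fun m => (d.1 m).2 f u

/-- The Lie bracket of `Γ(𝔇E)`: the commutator of operators, whose anchor is the Lie bracket of
vector fields. -/
def gaugeBracket [FiniteDimensional ℝ B] (d r : GaugeSec I F E) : GaugeSec I F E :=
  ⟨fun m => ⟨(gaugeOp (d.1 m) ∘ₗ act r - gaugeOp (r.1 m) ∘ₗ act d,
      mlieBracket I (fun p => gaugeAnchor (d.1 p)) (fun p => gaugeAnchor (r.1 p)) m), by
      intro f u
      have hd : gaugeOp (d.1 m) (fmul f (act r u)) = f m • gaugeOp (d.1 m) (act r u) +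
        mvfderiv I f m (gaugeAnchor (d.1 m)) • gaugeOp (r.1 m) u := (d.1 m).2 f (act r u)
      have hr : gaugeOp (r.1 m) (fmul f (act d u)) = f m • gaugeOp (r.1 m) (act d u) +
        mvfderiv I f m (gaugeAnchor (r.1 m)) • gaugeOp (d.1 m) u := (r.1 m).2 f (act d u)
      have hd' : gaugeOp (d.1 m) (fmul ⟨fun m => mvfderiv I f m (gaugeAnchor (r.1 m)),
          contMDiff_mvfderiv_apply f.contMDiff r.2.2⟩ u) =
        mvfderiv I f m (gaugeAnchor (r.1 m)) • gaugeOp (d.1 m) u +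
        mvfderiv I (fun m => mvfderiv I f m (gaugeAnchor (r.1 m))) m
          (gaugeAnchor (d.1 m)) • u m := (d.1 m).2 _ u
      have hr' : gaugeOp (r.1 m) (fmul ⟨fun m => mvfderiv I f m (gaugeAnchor (d.1 m)),
          contMDiff_mvfderiv_apply f.contMDiff d.2.2⟩ u) =
        mvfderiv I f m (gaugeAnchor (d.1 m)) • gaugeOp (r.1 m) u +
        mvfderiv I (fun m => mvfderiv I f m (gaugeAnchor (d.1 m))) m
          (gaugeAnchor (r.1 m)) • u m := (r.1 m).2 _ u
      have := FiniteDimensional.complete ℝ B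
      have hb := mvfderiv_mlieBracket f.contMDiff d.2.2 r.2.2 m
      change mvfderiv I f m (mlieBracket I (fun p => gaugeAnchor (d.1 p))
        (fun p => gaugeAnchor (r.1 p)) m) = _ at hb
      change gaugeOp (d.1 m) (act r (fmul f u)) - gaugeOp (r.1 m) (act d (fmul f u)) =
        f m • (gaugeOp (d.1 m) (act r u) - gaugeOp (r.1 m) (act d u)) +
        mvfderiv I f m (mlieBracket I (fun p => gaugeAnchor (d.1 p))
          (fun p => gaugeAnchor (r.1 p)) m) • u m
      rw [act_fmul, act_fmul, map_add, map_add, hd, hr, hd', hr', hb]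
      module⟩,
    ⟨fun u => (act d (act r u) - act r (act d u)).contMDiff,
      by
        have := FiniteDimensional.complete ℝ B
        have h2 : IsManifold I (minSmoothness ℝ 2) M :=
          IsManifold.of_le (n := ∞) (by
            rw [minSmoothness_of_isRCLikeNormedField]; exact WithTop.coe_le_coe.2 le_top)
        have h3 : IsManifold I (((⊤ : ℕ∞) : WithTop ℕ∞) + 1) M :=
          IsManifold.of_le (n := ∞) (by simp)
        exact ContDiff.mlieBracket_vectorField (m := ⊤) (n := ⊤) d.2.2 r.2.2 (by simp)⟩⟩

/-- `lam = 𝓛_𝔡 μ`, the Lie derivative of `μ ∈ Γ(𝔍E)` along `𝔡 ∈ Γ(𝔇E)`, characterized by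
`⟨𝓛_𝔡 μ, 𝔯⟩_E = 𝔡 ⟨μ, 𝔯⟩_E - ⟨μ, [𝔡, 𝔯]⟩_E` for all `𝔯 ∈ Γ(𝔇E)`. -/
def IsLieDerivative [FiniteDimensional ℝ B] (d : GaugeSec I F E) (μ lam : JetSec I F E) : Prop :=
  ∀ r : GaugeSec I F E, pair lam r = act d (pair μ r) - pair μ (gaugeBracket d r)

/-- `Z` is the Dorfman bracket of `X = 𝔡 + μ` and `Y = 𝔯 + ν`, i.e.
`Z = [𝔡, 𝔯] + 𝓛_𝔡 ν - 𝓛_𝔯 μ + 𝕕 ⟨μ, 𝔯⟩_E`. -/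
def IsDorfmanBracket [FiniteDimensional ℝ B] (X Y Z : OmniSec I F E) : Prop :=
  ∃ lam₁ lam₂ : JetSec I F E, IsLieDerivative X.1 Y.2 lam₁ ∧ IsLieDerivative Y.1 X.2 lam₂ ∧
    Z = (gaugeBracket X.1 Y.1, lam₁ - lam₂ + jet (pair X.2 Y.1))

/-- A family of subspaces `L_m ⊆ 𝓔_m` is a smooth subbundle: near each point it has a finite
frame of smooth sections of `𝓔`. -/
def IsSubbundle (L : Π m : M, Submodule ℝ (Omni I F E m)) : Prop :=
  ∀ m : M, ∃ (k : ℕ) (e : Fin k → OmniSec I F E), ∀ᶠ p in 𝓝 m,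
    LinearIndependent ℝ (fun i => omniAt (e i) p) ∧
      Submodule.span ℝ (Set.range fun i => omniAt (e i) p) = L p

/-- A subspace of `𝓔_m` on which the `E`-valued form vanishes. -/
def IsIsotropic {m : M} (L : Submodule ℝ (Omni I F E m)) : Prop :=
  ∀ X ∈ L, ∀ Y ∈ L, omniPairing X Y = 0

/-- Dirac structures in the omni-Lie algebroid `𝓔`: subbundles which are maximal isotropic and
whose sections are closed under the Dorfman bracket. -/
structure IsDirac [FiniteDimensional ℝ B] (L : Π m : M, Submodule ℝ (Omni I F E m)) : Prop where
  subbundle : IsSubbundle L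
  maximal_isotropic : ∀ m, Maximal IsIsotropic (L m)
  closed : ∀ X Y : OmniSec I F E, (∀ m, omniAt X m ∈ L m) → (∀ m, omniAt Y m ∈ L m) →
    ∃ Z : OmniSec I F E, IsDorfmanBracket X Y Z ∧ ∀ m, omniAt Z m ∈ L m

variable (I F E)

/-- Smooth vector bundle maps `𝔍E → 𝔇E` over the identity of `M`: fibrewise linear maps sending
smooth sections to smooth sections. -/
structure JetToGauge where
  toFun : Π m : M, Jet I F E m →ₗ[ℝ] Gauge I F E m
  smooth : ∀ μ ∈ JetSec I F E, (fun m => toFun m (μ m)) ∈ GaugeSec I F E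

/-- Lie algebroid structures on `E`: an anchor `E → TM`, which is a smooth vector bundle map over
the identity, and a real Lie algebra bracket on `Γ(E)` with the Leibniz rule. -/
@[ext]
structure LieAlgebroid where
  anchor : Π m : M, E m →ₗ[ℝ] TangentSpace I m
  smooth_anchor : ContMDiff (I.prod 𝓘(ℝ, F)) I.tangent ∞
    (fun e : TotalSpace F E => (⟨e.1, anchor e.1 e.2⟩ : TangentBundle I M))
  bracket : Sec I F E →ₗ[ℝ] Sec I F E →ₗ[ℝ] Sec I F E
  bracket_self : ∀ u, bracket u u = 0
  jacobi : ∀ u v w,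
    bracket u (bracket v w) + bracket v (bracket w u) + bracket w (bracket u v) = 0
  leibniz : ∀ (u v : Sec I F E) (f : C^∞⟮I, M; ℝ⟯) (m : M),
    bracket u (fmul f v) m = f m • bracket u v m + mvfderiv I f m (anchor m (u m)) • v m

variable {I F E}

/-- The graph `L_φ = {(φ(μ), μ)}` of a bundle map `φ : 𝔍E → 𝔇E`. -/
def JetToGauge.graph (φ : JetToGauge I F E) (m : M) : Submodule ℝ (Omni I F E m) :=
  LinearMap.range ((φ.toFun m).prod LinearMap.id)

end OmniLie

end

/-! A bundle map `π : 𝔍E → 𝔇E` has isotropic graph exactly when `⟨ν, π μ⟩ = -⟨μ, π ν⟩`. Taking `ν =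
𝕕v` gives `π(μ) v = -⟨μ, π(𝕕v)⟩`, so `π` is determined by its values on one-jets, and `[u, v] =
π(𝕕u) v` is a skew bracket. It satisfies a Leibniz rule with anchor `α(π(𝕕u))`, because `π(𝕕u)` is a
section of `𝔇E`.

That this anchor depends only on `u(m)` is where the rank enters (`anchor_fmul_of_skew`): expanding
`[f u, g v]` in both orders and comparing the coefficients of `v`, for `u(m)`, `v(m)` independent,
makes it tensorial. Since `𝓛_𝔡 𝕕u = 𝕕(𝔡 u)`, closure of the graph on one-jets says `[π(𝕕u), π(𝕕v)] =
π(𝕕[u, v])`, which is the Jacobi identity (`jacobi_of_isDirac`).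

Conversely, a Lie algebroid defines `π(μ) v = -⟨μ, [v, ·]⟩`, with anchor `ρ(⟨μ, 1⟩)`. Closure for
arbitrary sections follows from the case of one-jets: the failure of closure is skew and linear over
functions in both sections of `𝔍E` (`jacobiDefect`), and one-jets of sections span `𝔍E` locally
(`JetFrame.exists_jetMul_eq_sum`). Maximality follows from isotropy, since an element of `𝔇E`
pairing to zero with all one-jets vanishes (`maximal_graph`). -/

noncomputable section

namespace OmniLie

variable {B : Type*} [NormedAddCommGroup B] [NormedSpace ℝ B]
  {H : Type*} [TopologicalSpace H] {I : ModelWithCorners ℝ B H}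
  {M : Type*} [TopologicalSpace M] [ChartedSpace H M] [IsManifold I ∞ M]
  {F : Type*} [NormedAddCommGroup F] [NormedSpace ℝ F]
  {E : M → Type*} [TopologicalSpace (TotalSpace F E)]
  [∀ m, AddCommGroup (E m)] [∀ m, Module ℝ (E m)] [∀ m, TopologicalSpace (E m)]
  [FiberBundle F E] [VectorBundle ℝ F E]

/-! ### Local frames and coordinates, extended globally by cutoff -/

section Frames

variable [FiniteDimensional ℝ B] [T2Space M]

theorem exists_bump {m : M} {s : Set M} (hs : s ∈ 𝓝 m) :
    ∃ χ : C^∞⟮I, M; ℝ⟯, (∀ᶠ p in 𝓝 m, χ p = 1) ∧ tsupport χ ⊆ s := by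
  obtain ⟨f, -, hf⟩ := (SmoothBumpFunction.nhds_basis_tsupport (I := I) m).mem_iff.1 hs
  exact ⟨⟨f, f.contMDiff⟩, f.eventuallyEq_one, hf⟩

theorem exists_frame [FiniteDimensional ℝ F] [ContMDiffVectorBundle ∞ F E I] (m : M) :
    ∃ (e : Fin (Module.finrank ℝ F) → Sec I F E)
      (ε : Fin (Module.finrank ℝ F) → Π p : M, E p →ₗ[ℝ] ℝ),
      (∀ i, ContMDiff (I.prod 𝓘(ℝ, F)) 𝓘(ℝ, ℝ) ∞ (fun v : TotalSpace F E => ε i v.1 v.2)) ∧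
      ∀ᶠ p in 𝓝 m, (∀ i j, ε i p (e j p) = if i = j then 1 else 0) ∧
        ∀ v : E p, ∑ i, ε i p v • e i p = v := by
  have : ContMDiffVectorBundle 1 F E I := ContMDiffVectorBundle.of_le (n := ∞) (by simp)
  set t := trivializationAt F E m
  set b := Module.finBasis ℝ F
  have hm : t.baseSet ∈ 𝓝 m := t.open_baseSet.mem_nhds (mem_baseSet_trivializationAt F E m)
  obtain ⟨χ, hχ, hχs⟩ := exists_bump (I := I) hm
  refine ⟨fun i => ⟨fun p => χ p • t.localFrame b i p, ?_⟩,
    fun i p => χ p • t.localFrameCoeff I b i p, ?_, ?_⟩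
  · exact ContMDiffOn.smul_section_of_tsupport χ.contMDiff.contMDiffOn t.open_baseSet hχs
      (t.contMDiffOn_localFrame_baseSet ∞ b i)
  · intro i
    let c : F →L[ℝ] ℝ := LinearMap.toContinuousLinearMap (b.coord i)
    have hs : ∀ v : TotalSpace F E, v.1 ∈ t.baseSet →
        t.localFrameCoeff I b i v.1 v.2 = c (t v).2 := by
      intro v hv
      classical
      -- The vector is extended by zero to a section, so that the formula for coefficients of
      -- sections applies; no continuity is needed.
      have := t.localFrameCoeff_eq_coeff (I := I) (b := b) hv (i := i)
        (s := Function.update 0 v.1 v.2)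
      simp only [Function.update_self] at this
      exact this
    refine contMDiff_of_tsupport fun v hv => ?_
    have hv' : v.1 ∈ t.baseSet := hχs (tsupport_comp_subset_preimage (χ : M → ℝ)
      (FiberBundle.continuous_proj F E) (tsupport_smul_subset_left
        (fun v : TotalSpace F E => χ v.1) (fun v => t.localFrameCoeff I b i v.1 v.2) hv))
    have h1 : ContMDiffAt (I.prod 𝓘(ℝ, F)) 𝓘(ℝ, ℝ) ∞ (fun v : TotalSpace F E => c (t v).2) v :=
      c.contMDiff.contMDiffAt.comp v (contMDiffAt_snd.comp v
        (t.contMDiffOn.contMDiffAt (t.open_source.mem_nhds (t.mem_source.2 hv'))))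
    refine (χ.contMDiff.contMDiffAt.comp v (Bundle.contMDiff_proj E).contMDiffAt).smul
      (h1.congr_of_eventuallyEq ?_)
    filter_upwards [(t.open_baseSet.preimage (FiberBundle.continuous_proj F E)).mem_nhds hv']
      with w hw
    exact hs w hw
  · filter_upwards [hχ, hm] with p hp hpm
    refine ⟨fun i j => ?_, fun v => ?_⟩
    · change χ p • t.localFrameCoeff I b i p (χ p • t.localFrame b j p) = _
      rw [hp, one_smul, one_smul, t.localFrameCoeff_apply_of_mem_baseSet b hpm (t.localFrame b j),
        t.localFrame_apply_of_mem_baseSet b hpm, Module.Basis.repr_self, Finsupp.single_apply]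
      simp [eq_comm]
    · change ∑ i, (χ p • t.localFrameCoeff I b i p v) • χ p • t.localFrame b i p = v
      classical
      have := t.eq_sum_localFrameCoeff_smul (I := I) (b := b) hpm (s := Function.update 0 p v)
      simp only [Function.update_self] at this
      simpa [hp] using this.symm

/-- The trivialization of `TM` at `m` is the derivative of the chart at `m`, so the differentials of
the chart components are dual to its local frame. Cutting both off preserves this wherever the bump
function is locally one. -/
theorem exists_coordinates (m : M) :
    ∃ (x : Fin (Module.finrank ℝ B) → C^∞⟮I, M; ℝ⟯)
      (X : Fin (Module.finrank ℝ B) → Sec I B (TangentSpace I : M → Type _)),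
      ∀ᶠ p in 𝓝 m, (∀ i j, mvfderiv I (x i) p (X j p) = if i = j then 1 else 0) ∧
        ∀ v : TangentSpace I p, ∑ i, mvfderiv I (x i) p v • X i p = v := by
  have : IsManifold I 1 M := IsManifold.of_le (n := ∞) (by simp)
  have : ContMDiffVectorBundle ∞ B (TangentSpace I : M → Type _) I := inferInstance
  set t := trivializationAt B (TangentSpace I : M → Type _) m
  set b := Module.finBasis ℝ B
  have hm : t.baseSet ∈ 𝓝 m :=
    t.open_baseSet.mem_nhds (mem_baseSet_trivializationAt B (TangentSpace I : M → Type _) m)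
  obtain ⟨χ, hχ, hχs⟩ := exists_bump (I := I) hm
  let c : Fin (Module.finrank ℝ B) → B →L[ℝ] ℝ := fun i =>
    LinearMap.toContinuousLinearMap (b.coord i)
  refine ⟨fun i => ⟨fun p => χ p • c i (extChartAt I m p), ?_⟩,
    fun i => ⟨fun p => χ p • t.localFrame b i p, ?_⟩, ?_⟩
  · refine contMDiff_of_tsupport fun x hx => ?_
    have hx' : x ∈ t.baseSet := hχs (tsupport_smul_subset_left (χ : M → ℝ)
      (fun p => c i (extChartAt I m p)) hx)
    exact χ.contMDiff.contMDiffAt.smul ((c i).contMDiff.contMDiffAt.comp x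
      (contMDiffAt_extChartAt' hx'))
  · exact ContMDiffOn.smul_section_of_tsupport χ.contMDiff.contMDiffOn t.open_baseSet hχs
      (t.contMDiffOn_localFrame_baseSet ∞ b i)
  · filter_upwards [hχ.eventually_nhds, hm] with p hp hpm
    have hp1 : χ p = 1 := hp.self_of_nhds
    have key : ∀ i (v : TangentSpace I p),
        mvfderiv I (fun p => χ p • c i (extChartAt I m p)) p v =
          (t.basisAt b hpm).repr v i := by
      intro i v
      have h1 : (fun p => χ p • c i (extChartAt I m p)) =ᶠ[𝓝 p] (c i ∘ extChartAt I m) := by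
        filter_upwards [hp] with q hq
        simp [hq]
      have h2 : HasMFDerivAt I 𝓘(ℝ, ℝ) (c i ∘ extChartAt I m) p
          ((c i).comp (mfderiv I 𝓘(ℝ, B) (extChartAt I m) p)) :=
        (c i).hasMFDerivAt.comp p (mdifferentiableAt_extChartAt hpm).hasMFDerivAt
      change mfderiv I 𝓘(ℝ, ℝ) (fun p => χ p • c i (extChartAt I m p)) p v = _
      rw [(h2.congr_of_eventuallyEq h1).mfderiv,
        ← TangentBundle.continuousLinearMapAt_trivializationAt hpm]
      change b.repr (t.continuousLinearMapAt ℝ p v) i = _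
      simp [Trivialization.basisAt, hpm]
    refine ⟨fun i j => ?_, fun v => ?_⟩
    · refine (key i _).trans ?_
      change (t.basisAt b hpm).repr (χ p • t.localFrame b j p) i = _
      rw [hp1, one_smul, t.localFrame_apply_of_mem_baseSet b hpm, Module.Basis.repr_self,
        Finsupp.single_apply]
      simp [eq_comm]
    · refine (Finset.sum_congr rfl fun i _ => ?_).trans ((t.basisAt b hpm).sum_repr v)
      change _ • χ p • t.localFrame b i p = _
      rw [hp1, one_smul, t.localFrame_apply_of_mem_baseSet b hpm]
      exact congrArg (· • _) (key i v)

end Frames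

/-! ### Function multiples, the identity operator and one-jets at a point -/

section Multiplication

/-- The product of a smooth function and a section of `𝔇E`. -/
def gaugeMul (f : C^∞⟮I, M; ℝ⟯) (d : GaugeSec I F E) : GaugeSec I F E :=
  ⟨fun m => f m • d.1 m, fun u => f.contMDiff.smul_section (d.2.1 u),
    f.contMDiff.smul_section d.2.2⟩

/-- The product of a smooth function and a section of `𝔍E`. -/
def jetMul (f : C^∞⟮I, M; ℝ⟯) (μ : JetSec I F E) : JetSec I F E :=
  ⟨fun m => f m • μ.1 m, fun d hd => f.contMDiff.smul_section (μ.2 d hd)⟩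

variable (I F E) in
/-- The identity of `E`, as a section of `𝔇E` with anchor zero. -/
def gaugeOne : GaugeSec I F E :=
  ⟨fun _ => gaugeOfEnd LinearMap.id, fun u => u.contMDiff,
    (0 : ContMDiffSection I B ∞ (TangentSpace I : M → Type _)).contMDiff⟩

variable (I F E) in
/-- The one-jet at a point, as a linear map on sections. -/
def jetAt (m : M) : Sec I F E →ₗ[ℝ] Jet I F E m where
  toFun u := (jet u).1 m
  map_add' u v := Subtype.ext <| LinearMap.ext fun δ => map_add (gaugeOp δ) u v
  map_smul' c u := Subtype.ext <| LinearMap.ext fun δ => map_smul (gaugeOp δ) c u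

theorem jetAt_apply {m : M} (u : Sec I F E) (δ : Gauge I F E m) :
    (jetAt I F E m u).1 δ = gaugeOp δ u := rfl

omit [IsManifold I ∞ M] in
theorem gaugeOp_fmul {m : M} (δ : Gauge I F E m) (f : C^∞⟮I, M; ℝ⟯) (u : Sec I F E) :
    gaugeOp δ (fmul f u) = f m • gaugeOp δ u + mvfderiv I f m (gaugeAnchor δ) • u m :=
  δ.2 f u

omit [IsManifold I ∞ M] in
theorem gauge_ext {m : M} {δ δ' : Gauge I F E m} (h : ∀ u, gaugeOp δ u = gaugeOp δ' u)
    (h' : gaugeAnchor δ = gaugeAnchor δ') : δ = δ' :=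
  Subtype.ext (Prod.ext (LinearMap.ext h) h')

omit [IsManifold I ∞ M] in
@[simp] theorem gaugeOp_sub {m : M} (δ δ' : Gauge I F E m) (u : Sec I F E) :
    gaugeOp (δ - δ') u = gaugeOp δ u - gaugeOp δ' u := rfl

omit [IsManifold I ∞ M] in
@[simp] theorem gaugeOp_smul {m : M} (c : ℝ) (δ : Gauge I F E m) (u : Sec I F E) :
    gaugeOp (c • δ) u = c • gaugeOp δ u := rfl

omit [IsManifold I ∞ M] in
@[simp] theorem gaugeAnchor_sub {m : M} (δ δ' : Gauge I F E m) :
    gaugeAnchor (δ - δ') = gaugeAnchor δ - gaugeAnchor δ' := rfl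

omit [IsManifold I ∞ M] in
theorem gaugeOp_sum {m : M} {ι : Type*} (s : Finset ι) (δ : ι → Gauge I F E m) (u : Sec I F E) :
    gaugeOp (∑ i ∈ s, δ i) u = ∑ i ∈ s, gaugeOp (δ i) u :=
  map_sum ({ toFun := fun δ => gaugeOp δ u, map_add' := fun _ _ => rfl,
             map_smul' := fun _ _ => rfl } : Gauge I F E m →ₗ[ℝ] E m) δ s

omit [IsManifold I ∞ M] in
theorem gaugeAnchor_sum {m : M} {ι : Type*} (s : Finset ι) (δ : ι → Gauge I F E m) :
    gaugeAnchor (∑ i ∈ s, δ i) = ∑ i ∈ s, gaugeAnchor (δ i) :=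
  map_sum ({ toFun := fun δ => gaugeAnchor δ, map_add' := fun _ _ => rfl,
             map_smul' := fun _ _ => rfl } : Gauge I F E m →ₗ[ℝ] TangentSpace I m) δ s

end Multiplication

/-! ### Local frames of the jet bundle -/

section JetFrame

variable (I F E) in
/-- A frame of `E` near `m`, with its dual frame, coordinates of `M` near `m`, and sections of
`𝔇E` which annihilate the frame and lift the coordinate vector fields. -/
structure JetFrame (m : M) where
  sec : Fin (Module.finrank ℝ F) → Sec I F E
  coeff : Fin (Module.finrank ℝ F) → Π p : M, E p →ₗ[ℝ] ℝ
  coord : Fin (Module.finrank ℝ B) → C^∞⟮I, M; ℝ⟯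
  conn : Fin (Module.finrank ℝ B) → GaugeSec I F E
  dom : Set M
  smooth_coeff : ∀ i, ContMDiff (I.prod 𝓘(ℝ, F)) 𝓘(ℝ, ℝ) ∞
    (fun v : TotalSpace F E => coeff i v.1 v.2)
  isOpen_dom : IsOpen dom
  mem_dom : m ∈ dom
  coeff_sec : ∀ p ∈ dom, ∀ i j, coeff i p (sec j p) = if i = j then 1 else 0
  sum_coeff : ∀ p ∈ dom, ∀ v : E p, ∑ i, coeff i p v • sec i p = v
  conn_sec : ∀ p ∈ dom, ∀ i j, gaugeOp ((conn j).1 p) (sec i) = 0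
  deriv_conn : ∀ p ∈ dom, ∀ i j,
    mvfderiv I (coord i) p (gaugeAnchor ((conn j).1 p)) = if i = j then 1 else 0
  sum_deriv : ∀ p ∈ dom, ∀ v : TangentSpace I p,
    ∑ i, mvfderiv I (coord i) p v • gaugeAnchor ((conn i).1 p) = v

theorem exists_jetFrame [FiniteDimensional ℝ B] [T2Space M] [FiniteDimensional ℝ F]
    [ContMDiffVectorBundle ∞ F E I] (m : M) : Nonempty (JetFrame I F E m) := by
  obtain ⟨e, ε, hε', he⟩ := exists_frame (I := I) (F := F) (E := E) m
  have hε : ∀ i (u : Sec I F E), ContMDiff I 𝓘(ℝ, ℝ) ∞ (fun p => ε i p (u p)) :=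
    fun i u => (hε' i).comp u.contMDiff
  obtain ⟨x, X, hx⟩ := exists_coordinates (I := I) m
  obtain ⟨U, hU, hUo, hmU⟩ := eventually_nhds_iff.1 (he.and hx)
  obtain ⟨χ, hχ, hχU⟩ := exists_bump (I := I) (hUo.mem_nhds hmU)
  obtain ⟨V, hV, hVo, hmV⟩ := eventually_nhds_iff.1 hχ
  have hdiff : ∀ i (u : Sec I F E) p, MDifferentiableAt I 𝓘(ℝ, ℝ) (fun p => ε i p (u p)) p :=
    fun i u p => (hε i u).mdifferentiableAt (by simp)
  -- The Leibniz rule below needs `∑ εᵢ(u) eᵢ = u`, which holds only on `U`; off `U` the factor `χ`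
  -- makes every term zero.
  have hχ0 : ∀ p, p ∈ U ∨ χ p = 0 := fun p => by
    by_cases h : p ∈ U
    · exact Or.inl h
    · exact Or.inr (image_eq_zero_of_notMem_tsupport fun h' => h (hχU h'))
  have hX : ∀ j, ContMDiff I I.tangent ∞ (fun p => (⟨p, χ p • X j p⟩ : TangentBundle I M)) :=
    fun j => χ.contMDiff.smul_section (X j).contMDiff
  -- The flat connection of the frame, along `χ Xⱼ`: differentiate the coefficients and keep the
  -- `eᵢ` fixed.
  let op : Fin (Module.finrank ℝ B) → Π p : M, Sec I F E →ₗ[ℝ] E p := fun j p =>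
    { toFun := fun u => ∑ i, mvfderiv I (fun q => ε i q (u q)) p (χ p • X j p) • e i p
      map_add' := fun u v => by
        rw [← Finset.sum_add_distrib]
        refine Finset.sum_congr rfl fun i _ => ?_
        have : (fun q => ε i q ((u + v) q)) = fun q => ε i q (u q) + ε i q (v q) := by
          funext q
          exact map_add (ε i q) (u q) (v q)
        rw [this, mvfderiv_fun_add (hdiff i u p) (hdiff i v p), add_apply,
          add_smul]
      map_smul' := fun c u => by
        rw [Finset.smul_sum]
        refine Finset.sum_congr rfl fun i _ => ?_
        have : (fun q => ε i q ((c • u) q)) = fun q => c * ε i q (u q) := by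
          funext q
          exact map_smul (ε i q) c (u q)
        rw [this, mvfderiv_fun_mul mdifferentiableAt_const (hdiff i u p), mvfderiv_const]
        simp only [smul_zero, add_zero, FunLike.coe_smul, Pi.smul_apply, smul_eq_mul, mul_smul,
          RingHom.id_apply] }
  have hop : ∀ j p (f : C^∞⟮I, M; ℝ⟯) (u : Sec I F E),
      op j p (fmul f u) = f p • op j p u + mvfderiv I f p (χ p • X j p) • u p := by
    intro j p f u
    rcases hχ0 p with hp | hp
    · have h1 : ∀ i, mvfderiv I (fun q => ε i q (fmul f u q)) p (χ p • X j p) =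
          f p * mvfderiv I (fun q => ε i q (u q)) p (χ p • X j p) +
            ε i p (u p) * mvfderiv I f p (χ p • X j p) := by
        intro i
        have : (fun q => ε i q (fmul f u q)) = fun q => f q * ε i q (u q) := by
          funext q
          exact map_smul (ε i q) (f q) (u q)
        rw [this, mvfderiv_fun_mul (f.contMDiff.mdifferentiableAt (by simp)) (hdiff i u p)]
        rfl
      have h2 := (hU p hp).1.2 (u p)
      change ∑ i, mvfderiv I (fun q => ε i q (fmul f u q)) p (χ p • X j p) • e i p =
        f p • ∑ i, mvfderiv I (fun q => ε i q (u q)) p (χ p • X j p) • e i p + _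
      conv_rhs => rw [← h2]
      rw [Finset.smul_sum, Finset.smul_sum, ← Finset.sum_add_distrib]
      refine Finset.sum_congr rfl fun i _ => ?_
      rw [h1]
      module
    · simp [op, hp]
  refine ⟨⟨e, ε, x, fun j => ⟨fun p => ⟨(op j p, χ p • X j p), hop j p⟩, fun u => ?_, hX j⟩,
    U ∩ V, hε', hUo.inter hVo, ⟨hmU, hmV⟩, fun p hp => (hU p hp.1).1.1, fun p hp => (hU p hp.1).1.2,
    fun p hp i j => ?_, fun p hp i j => ?_, fun p hp v => ?_⟩⟩
  · change ContMDiff I (I.prod 𝓘(ℝ, F)) ∞ (fun p => (⟨p,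
      ∑ i, mvfderiv I (fun q => ε i q (u q)) p (χ p • X j p) • e i p⟩ : TotalSpace F E))
    exact ContMDiff.sum_section fun i _ =>
      (contMDiff_mvfderiv_apply (hε i u) (hX j)).smul_section (e i).contMDiff
  · change ∑ k, mvfderiv I (fun q => ε k q (e i q)) p (χ p • X j p) • e k p = 0
    refine Finset.sum_eq_zero fun k _ => ?_
    have h1 : (fun q => ε k q (e i q)) =ᶠ[𝓝 p] fun _ => if k = i then (1 : ℝ) else 0 := by
      filter_upwards [hUo.mem_nhds hp.1] with q hq
      exact (hU q hq).1.1 k i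
    have h2 : mvfderiv I (fun q => ε k q (e i q)) p (χ p • X j p) = 0 := by
      change mfderiv I 𝓘(ℝ, ℝ) (fun q => ε k q (e i q)) p (χ p • X j p) = 0
      rw [h1.mfderiv_eq, mfderiv_const]
      rfl
    rw [h2, zero_smul]
  · change mvfderiv I (x i) p (χ p • X j p) = _
    rw [hV p hp.2, one_smul]
    exact (hU p hp.1).2.1 i j
  · change ∑ i, mvfderiv I (x i) p v • χ p • X i p = v
    rw [hV p hp.2]
    simp only [one_smul]
    exact (hU p hp.1).2.2 v

namespace JetFrame

variable {m : M} (Φ : JetFrame I F E m)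

/-- The coefficient functions of a section with respect to the frame. -/
def coeffMap (i : Fin (Module.finrank ℝ F)) (u : Sec I F E) : C^∞⟮I, M; ℝ⟯ :=
  ⟨fun p => Φ.coeff i p (u p), (Φ.smooth_coeff i).comp u.contMDiff⟩

variable [FiniteDimensional ℝ B] [T2Space M]

/-- With a bump function `χ` supported in the domain, `χ u = ∑ χ εᵢ(u) eᵢ` holds globally, so
tensoriality alone localizes `T` at `p`. -/
theorem eq_sum_of_tensorial {W : Type*} [AddCommGroup W] [Module ℝ W] {p : M} (hp : p ∈ Φ.dom)
    (T : Sec I F E →ₗ[ℝ] W) (hT : ∀ f u, T (fmul f u) = f p • T u) (u : Sec I F E) :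
    T u = ∑ i, Φ.coeff i p (u p) • T (Φ.sec i) := by
  obtain ⟨χ, hχ, hχU⟩ := exists_bump (I := I) (Φ.isOpen_dom.mem_nhds hp)
  have hχp : χ p = 1 := hχ.self_of_nhds
  have h1 : fmul χ u = ∑ i, fmul χ (fmul (Φ.coeffMap i u) (Φ.sec i)) := by
    refine ContMDiffSection.ext fun q => ?_
    change χ q • u q = evalAt I F E q (∑ i, fmul χ (fmul (Φ.coeffMap i u) (Φ.sec i)))
    rw [map_sum]
    change χ q • u q = ∑ i, χ q • Φ.coeff i q (u q) • Φ.sec i q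
    rw [← Finset.smul_sum]
    by_cases hq : q ∈ Φ.dom
    · rw [Φ.sum_coeff q hq]
    · rw [image_eq_zero_of_notMem_tsupport fun h' => hq (hχU h'), zero_smul, zero_smul]
  have h3 := congrArg T h1
  simp only [map_sum, hT, hχp, one_smul] at h3
  exact h3

theorem eq_gaugeOfEnd {p : M} (hp : p ∈ Φ.dom) (δ : Gauge I F E p) (hδ : gaugeAnchor δ = 0) :
    δ = gaugeOfEnd (∑ i, (Φ.coeff i p).smulRight (gaugeOp δ (Φ.sec i))) := by
  refine gauge_ext (fun u => ?_) hδ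
  rw [Φ.eq_sum_of_tensorial hp (gaugeOp δ) (fun f v => by
    rw [gaugeOp_fmul, hδ, map_zero, zero_smul, add_zero]) u]
  change _ = (∑ i, (Φ.coeff i p).smulRight (gaugeOp δ (Φ.sec i))) (u p)
  rw [LinearMap.sum_apply]
  rfl

/-- Subtracting from `δ` its horizontal part leaves an operator with anchor zero, hence an
endomorphism `Ψ` of the fibre, on which the jet condition gives `ν(Ψ) = Ψ(ν(1))`. -/
theorem jet_apply_eq_sum {p : M} (hp : p ∈ Φ.dom) (ν : Jet I F E p) (δ : Gauge I F E p) :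
    ν.1 δ = ∑ i, Φ.coeff i p (ν.1 ((gaugeOne I F E).1 p)) • gaugeOp δ (Φ.sec i) +
      ∑ k, mvfderiv I (Φ.coord k) p (gaugeAnchor δ) • ν.1 ((Φ.conn k).1 p) := by
  set δ' := δ - ∑ k, mvfderiv I (Φ.coord k) p (gaugeAnchor δ) • (Φ.conn k).1 p with hδ'
  have h0 : gaugeAnchor δ' = 0 := by
    rw [hδ', gaugeAnchor_sub, gaugeAnchor_sum, sub_eq_zero]
    exact (Φ.sum_deriv p hp _).symm
  have h1 : ∀ i, gaugeOp δ' (Φ.sec i) = gaugeOp δ (Φ.sec i) := by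
    intro i
    simp [hδ', gaugeOp_sum, Φ.conn_sec p hp]
  have h2 : δ = δ' + ∑ k, mvfderiv I (Φ.coord k) p (gaugeAnchor δ) • (Φ.conn k).1 p := by
    rw [hδ', sub_add_cancel]
  have h3 : ν.1 δ' = ∑ i, Φ.coeff i p (ν.1 ((gaugeOne I F E).1 p)) • gaugeOp δ (Φ.sec i) := by
    rw [Φ.eq_gaugeOfEnd hp δ' h0, ν.2 _, LinearMap.sum_apply]
    exact Finset.sum_congr rfl fun i _ => by rw [h1]; rfl
  conv_lhs => rw [h2]
  rw [map_add, map_sum, h3]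
  simp only [map_smul]

/-- The sections `eᵢ` and `xⱼ eᵢ`, whose one-jets are a frame of `𝔍E`. -/
def jetSections : Fin (Module.finrank ℝ F) ⊕
    (Fin (Module.finrank ℝ F) × Fin (Module.finrank ℝ B)) → Sec I F E :=
  Sum.elim Φ.sec fun k => fmul (Φ.coord k.2) (Φ.sec k.1)

/-- The coefficients of a section of `𝔍E` in the frame of the one-jets of `jetSections`. -/
def jetCoeff (μ : JetSec I F E) : Fin (Module.finrank ℝ F) ⊕
    (Fin (Module.finrank ℝ F) × Fin (Module.finrank ℝ B)) → C^∞⟮I, M; ℝ⟯ :=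
  Sum.elim (fun i => Φ.coeffMap i (pair μ (gaugeOne I F E)) -
      ∑ k, Φ.coeffMap i (pair μ (Φ.conn k)) * Φ.coord k)
    fun k => Φ.coeffMap k.1 (pair μ (Φ.conn k.2))

/-- The symbol `dxₖ ⊗ eᵢ` equals `𝕕(xₖ eᵢ) - xₖ 𝕕eᵢ`; the second term is the correction in the
coefficient of `𝕕eᵢ`. -/
theorem jet_eq_sum {p : M} (hp : p ∈ Φ.dom) (ν : Jet I F E p) :
    ν = ∑ i, (Φ.coeff i p (ν.1 ((gaugeOne I F E).1 p)) -
        ∑ k, Φ.coeff i p (ν.1 ((Φ.conn k).1 p)) * Φ.coord k p) • jetAt I F E p (Φ.sec i) +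
      ∑ k : Fin (Module.finrank ℝ F) × Fin (Module.finrank ℝ B),
        Φ.coeff k.1 p (ν.1 ((Φ.conn k.2).1 p)) •
          jetAt I F E p (fmul (Φ.coord k.2) (Φ.sec k.1)) := by
  refine Subtype.ext (LinearMap.ext fun δ => ?_)
  have h : ∀ k, ν.1 ((Φ.conn k).1 p) =
      ∑ i, Φ.coeff i p (ν.1 ((Φ.conn k).1 p)) • Φ.sec i p := fun k =>
    (Φ.sum_coeff p hp _).symm
  rw [Φ.jet_apply_eq_sum hp ν δ]
  simp only [Submodule.coe_add, Submodule.coe_sum, Submodule.coe_smul, LinearMap.add_apply,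
    LinearMap.sum_apply, LinearMap.smul_apply, LinearMap.sub_apply, jetAt_apply, gaugeOp_fmul,
    Fintype.sum_prod_type, sub_smul, Finset.sum_sub_distrib, smul_add, Finset.sum_add_distrib,
    Finset.sum_smul, mul_smul]
  have h' : ∑ k, mvfderiv I (Φ.coord k) p (gaugeAnchor δ) • ν.1 ((Φ.conn k).1 p) =
      ∑ i, ∑ k, Φ.coeff i p (ν.1 ((Φ.conn k).1 p)) •
        mvfderiv I (Φ.coord k) p (gaugeAnchor δ) • Φ.sec i p := by
    rw [Finset.sum_comm]
    refine Finset.sum_congr rfl fun k _ => ?_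
    conv_lhs => rw [h k]
    rw [Finset.smul_sum]
    exact Finset.sum_congr rfl fun i _ => smul_comm _ _ _
  rw [h']
  abel

omit [FiniteDimensional ℝ B] [T2Space M] in
theorem linearIndependent_jetSections {p : M} (hp : p ∈ Φ.dom) :
    LinearIndependent ℝ fun k => jetAt I F E p (Φ.jetSections k) := by
  rw [Fintype.linearIndependent_iff]
  intro g hg
  have h : ∀ δ : Gauge I F E p, ∑ i, g (Sum.inl i) • gaugeOp δ (Φ.sec i) +
      ∑ i, ∑ k, g (Sum.inr (i, k)) • (Φ.coord k p • gaugeOp δ (Φ.sec i) +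
        mvfderiv I (Φ.coord k) p (gaugeAnchor δ) • Φ.sec i p) = 0 := by
    intro δ
    have := congrArg (fun ν : Jet I F E p => ν.1 δ) hg
    simp only [Fintype.sum_sum_type, Submodule.coe_add, Submodule.coe_sum, Submodule.coe_smul,
      LinearMap.add_apply, LinearMap.sum_apply, LinearMap.smul_apply, jetAt_apply, jetSections,
      Sum.elim_inl, Sum.elim_inr, gaugeOp_fmul, Fintype.sum_prod_type] at this
    exact this
  have hz : ∀ c : Fin (Module.finrank ℝ F) → ℝ, ∑ i, c i • Φ.sec i p = 0 → ∀ i, c i = 0 := by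
    intro c hc i
    have := congrArg (Φ.coeff i p) hc
    simpa [Φ.coeff_sec p hp] using this
  -- Pairing with the `k`-th horizontal lift kills every `𝕕eᵢ` and sees only `dxₖ`. Afterwards
  -- pairing with the identity isolates the remaining coefficients.
  have h1 : ∀ i k, g (Sum.inr (i, k)) = 0 := by
    intro i k
    have := h ((Φ.conn k).1 p)
    simp only [Φ.conn_sec p hp, Φ.deriv_conn p hp, smul_zero, Finset.sum_const_zero, zero_add,
      ite_smul, one_smul, zero_smul, smul_ite, Finset.sum_ite_eq', Finset.mem_univ, if_true] at this
    exact hz (fun i => g (Sum.inr (i, k))) this i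
  have h2 : ∀ i, g (Sum.inl i) = 0 := by
    have := h ((gaugeOne I F E).1 p)
    simp only [h1, zero_smul, Finset.sum_const_zero, add_zero] at this
    exact hz (fun i => g (Sum.inl i)) this
  rintro (i | ⟨i, k⟩)
  · exact h2 i
  · exact h1 i k

theorem span_jetSections {p : M} (hp : p ∈ Φ.dom) :
    Submodule.span ℝ (Set.range fun k => jetAt I F E p (Φ.jetSections k)) = ⊤ := by
  refine eq_top_iff.2 fun ν _ => ?_
  rw [Φ.jet_eq_sum hp ν]
  refine add_mem (sum_mem fun i _ => Submodule.smul_mem _ _ (Submodule.subset_span ?_))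
    (sum_mem fun k _ => Submodule.smul_mem _ _ (Submodule.subset_span ?_))
  · exact ⟨Sum.inl i, rfl⟩
  · exact ⟨Sum.inr k, rfl⟩

/-- Makes the local expansion into one-jets an identity of global sections, so that linear operators
on `Γ(𝔍E)` can be applied to it. -/
theorem exists_jetMul_eq_sum (μ : JetSec I F E) : ∃ χ : C^∞⟮I, M; ℝ⟯, χ m = 1 ∧
    jetMul χ μ = ∑ k, jetMul (χ * Φ.jetCoeff μ k) (jet (Φ.jetSections k)) := by
  obtain ⟨χ, hχ, hχU⟩ := exists_bump (I := I) (Φ.isOpen_dom.mem_nhds Φ.mem_dom)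
  refine ⟨χ, hχ.self_of_nhds, Subtype.ext (funext fun p => ?_)⟩
  rw [Submodule.coe_sum, Finset.sum_apply]
  change χ p • μ.1 p = ∑ k, (χ p * Φ.jetCoeff μ k p) • jetAt I F E p (Φ.jetSections k)
  simp only [mul_smul, ← Finset.smul_sum]
  by_cases hp : p ∈ Φ.dom
  · congr 1
    conv_lhs => rw [Φ.jet_eq_sum hp (μ.1 p)]
    rw [Fintype.sum_sum_type]
    congr 1
    refine Finset.sum_congr rfl fun i _ => ?_
    congr 1
    change _ = (Φ.coeffMap i (pair μ (gaugeOne I F E)) -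
      ∑ k, Φ.coeffMap i (pair μ (Φ.conn k)) * Φ.coord k) p
    have := map_sum (ContMDiffMap.evalRingHom (n := ∞) (I := I) (I' := 𝓘(ℝ, ℝ)) p)
      (fun k => Φ.coeffMap i (pair μ (Φ.conn k)) * Φ.coord k) Finset.univ
    change (∑ k, Φ.coeffMap i (pair μ (Φ.conn k)) * Φ.coord k) p = _ at this
    rw [ContMDiffMap.coe_sub, Pi.sub_apply, this]
    rfl
  · rw [image_eq_zero_of_notMem_tsupport fun h' => hp (hχU h'), zero_smul, zero_smul]

end JetFrame

end JetFrame

/-! ### Extending from one-jets to all sections -/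

section Tensoriality

variable [FiniteDimensional ℝ B] [T2Space M] [FiniteDimensional ℝ F] [ContMDiffVectorBundle ∞ F E I]

theorem exists_jetAt_eq {m : M} (ν : Jet I F E m) : ∃ u, jetAt I F E m u = ν := by
  obtain ⟨Φ⟩ := exists_jetFrame (I := I) (F := F) (E := E) m
  have h : Submodule.span ℝ (Set.range fun k => jetAt I F E m (Φ.jetSections k)) ≤
      LinearMap.range (jetAt I F E m) :=
    Submodule.span_le.2 (by rintro _ ⟨k, rfl⟩; exact ⟨_, rfl⟩)
  rw [Φ.span_jetSections Φ.mem_dom] at h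
  exact h (Submodule.mem_top (x := ν))

theorem exists_sec_eq {m : M} (v : E m) : ∃ u : Sec I F E, u m = v := by
  obtain ⟨Φ⟩ := exists_jetFrame (I := I) (F := F) (E := E) m
  refine ⟨∑ i, Φ.coeff i m v • Φ.sec i, ?_⟩
  change evalAt I F E m _ = v
  rw [map_sum]
  exact Φ.sum_coeff m Φ.mem_dom v

theorem tangent_ext {m : M} {v w : TangentSpace I m}
    (h : ∀ f : C^∞⟮I, M; ℝ⟯, mvfderiv I f m v = mvfderiv I f m w) : v = w := by
  obtain ⟨x, X, hx⟩ := exists_coordinates (I := I) m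
  rw [← hx.self_of_nhds.2 v, ← hx.self_of_nhds.2 w]
  exact Finset.sum_congr rfl fun i _ => by rw [h]

/-- In positive rank the anchor can be read off the operator, by applying it to `f e₀` with `e₀(m) ≠
0`. Identities in `𝔇E` thus need checking only on operators. -/
theorem gauge_ext_of_op (hF : 0 < Module.finrank ℝ F) {m : M} {δ δ' : Gauge I F E m}
    (h : ∀ u, gaugeOp δ u = gaugeOp δ' u) : δ = δ' := by
  obtain ⟨Φ⟩ := exists_jetFrame (I := I) (F := F) (E := E) m
  refine gauge_ext h (tangent_ext fun f => ?_)
  have h1 := h (fmul f (Φ.sec ⟨0, hF⟩))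
  rw [gaugeOp_fmul, gaugeOp_fmul, h, add_right_inj] at h1
  have h2 := congrArg (Φ.coeff ⟨0, hF⟩ m) h1
  simpa [Φ.coeff_sec m Φ.mem_dom] using h2

theorem gaugeSec_ext_of_op (hF : 0 < Module.finrank ℝ F) {d d' : GaugeSec I F E}
    (h : ∀ m u, gaugeOp (d.1 m) u = gaugeOp (d'.1 m) u) : d = d' :=
  Subtype.ext (funext fun m => gauge_ext_of_op hF (h m))

/-- A tensorial operator on `Γ(𝔍E)` which vanishes on one-jets of sections is zero. -/
theorem eq_zero_of_jet {W : Type*} [AddCommGroup W] [Module ℝ W] {m : M}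
    (T : JetSec I F E →ₗ[ℝ] W) (hT : ∀ f μ, T (jetMul f μ) = f m • T μ)
    (h : ∀ u, T (jet u) = 0) (μ : JetSec I F E) : T μ = 0 := by
  obtain ⟨Φ⟩ := exists_jetFrame (I := I) (F := F) (E := E) m
  obtain ⟨χ, hχ, hμ⟩ := Φ.exists_jetMul_eq_sum μ
  have := congrArg T hμ
  simpa [hT, h, hχ] using this

end Tensoriality

/-! ### Lie derivatives of jets and the bracket of `𝔇E` -/

section LieDerivative

/-- The pairing with a section of `𝔇E`, as a linear map on `Γ(𝔍E)`. -/
def pairLeft (r : GaugeSec I F E) : JetSec I F E →ₗ[ℝ] Sec I F E where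
  toFun μ := pair μ r
  map_add' _ _ := rfl
  map_smul' _ _ := rfl

/-- The pairing with an element of `(𝔇E)_m`, as a linear map on `Γ(𝔍E)`. -/
def pairLeftAt {m : M} (δ : Gauge I F E m) : JetSec I F E →ₗ[ℝ] E m where
  toFun μ := (μ.1 m).1 δ
  map_add' _ _ := rfl
  map_smul' _ _ := rfl

variable [FiniteDimensional ℝ B]

theorem gaugeOp_gaugeBracket (d r : GaugeSec I F E) (m : M) (u : Sec I F E) :
    gaugeOp ((gaugeBracket d r).1 m) u =
      gaugeOp (d.1 m) (act r u) - gaugeOp (r.1 m) (act d u) := rfl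

/-- The value at `m` of `⟨𝓛_𝔡 μ, 𝔯⟩_E`. -/
def lieDerivAt (d r : GaugeSec I F E) (m : M) : JetSec I F E →ₗ[ℝ] E m :=
  gaugeOp (d.1 m) ∘ₗ pairLeft r - pairLeftAt ((gaugeBracket d r).1 m)

theorem lieDerivAt_apply (d r : GaugeSec I F E) (m : M) (μ : JetSec I F E) :
    lieDerivAt d r m μ = gaugeOp (d.1 m) (pair μ r) - (μ.1 m).1 ((gaugeBracket d r).1 m) := rfl

theorem IsLieDerivative.apply {d : GaugeSec I F E} {μ lam : JetSec I F E}
    (h : IsLieDerivative d μ lam) (r : GaugeSec I F E) (m : M) :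
    (lam.1 m).1 (r.1 m) = lieDerivAt d r m μ :=
  congrArg (fun s : Sec I F E => s m) (h r)

/-- In `𝔡(𝔯 u) - [𝔡, 𝔯] u` only `𝔯(𝔡 u)` survives, i.e. `𝓛_𝔡 𝕕u = 𝕕(𝔡 u)`. -/
theorem lieDerivAt_jet (d r : GaugeSec I F E) (m : M) (u : Sec I F E) :
    lieDerivAt d r m (jet u) = gaugeOp (r.1 m) (act d u) :=
  sub_sub_cancel (gaugeOp (d.1 m) (act r u)) (gaugeOp (r.1 m) (act d u))

theorem lieDerivAt_jetMul (d r : GaugeSec I F E) (m : M) (f : C^∞⟮I, M; ℝ⟯) (μ : JetSec I F E) :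
    lieDerivAt d r m (jetMul f μ) = f m • lieDerivAt d r m μ +
      mvfderiv I f m (gaugeAnchor (d.1 m)) • (μ.1 m).1 (r.1 m) := by
  have h1 : pair (jetMul f μ) r = fmul f (pair μ r) := rfl
  have h2 : ∀ δ, ((jetMul f μ).1 m).1 δ = f m • (μ.1 m).1 δ := fun _ => rfl
  have h3 : pair μ r m = (μ.1 m).1 (r.1 m) := rfl
  rw [lieDerivAt_apply, lieDerivAt_apply, h1, h2, gaugeOp_fmul, h3, smul_sub]
  abel

theorem lieDerivAt_sum {ι : Type*} (s : Finset ι) (d r : GaugeSec I F E) (m : M)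
    (f : ι → C^∞⟮I, M; ℝ⟯) (u : ι → Sec I F E) :
    lieDerivAt d r m (∑ k ∈ s, jetMul (f k) (jet (u k))) =
      ∑ k ∈ s, (f k m • gaugeOp (r.1 m) (act d (u k)) +
        mvfderiv I (f k) m (gaugeAnchor (d.1 m)) • gaugeOp (r.1 m) (u k)) := by
  refine (map_sum (lieDerivAt d r m) (fun k => jetMul (f k) (jet (u k))) s).trans
    (Finset.sum_congr rfl fun k _ => ?_)
  rw [lieDerivAt_jetMul, lieDerivAt_jet]
  rfl

/-- Exhibits a single element of `(𝔍E)_m` representing `𝓛_𝔡 μ` at `m`: the value depends on `𝔯` only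
through `𝔯_m` and obeys the jet condition. As `χ` is only known to be one at `m` itself, its
derivative has to be subtracted. -/
theorem lieDerivAt_eq_of_sum {ι : Type*} [Fintype ι] (d : GaugeSec I F E) {m : M}
    {μ : JetSec I F E} {χ : C^∞⟮I, M; ℝ⟯} {f : ι → C^∞⟮I, M; ℝ⟯} {u : ι → Sec I F E}
    (hχ : χ m = 1) (hμ : jetMul χ μ = ∑ k, jetMul (f k) (jet (u k))) (r : GaugeSec I F E) :
    (∑ k, (f k m • jetAt I F E m (act d (u k)) +
      mvfderiv I (f k) m (gaugeAnchor (d.1 m)) • jetAt I F E m (u k)) -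
      mvfderiv I χ m (gaugeAnchor (d.1 m)) • μ.1 m).1 (r.1 m) = lieDerivAt d r m μ := by
  have h1 := lieDerivAt_jetMul d r m χ μ
  rw [hμ, lieDerivAt_sum] at h1
  have h2 := sub_eq_of_eq_add h1
  rw [show χ m • lieDerivAt d r m μ = lieDerivAt d r m μ by
    generalize lieDerivAt d r m μ = y; rw [hχ, one_smul]] at h2
  rw [← h2, Submodule.coe_sub, LinearMap.sub_apply, Submodule.coe_sum, LinearMap.sum_apply]
  rfl

theorem exists_isLieDerivative [T2Space M] [FiniteDimensional ℝ F] [ContMDiffVectorBundle ∞ F E I]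
    (d : GaugeSec I F E) (μ : JetSec I F E) : ∃ lam, IsLieDerivative d μ lam := by
  have key : ∀ m, ∃ lam : Jet I F E m, ∀ r : GaugeSec I F E,
      lam.1 (r.1 m) = lieDerivAt d r m μ := by
    intro m
    obtain ⟨Φ⟩ := exists_jetFrame (I := I) (F := F) (E := E) m
    obtain ⟨χ, hχ, hμ⟩ := Φ.exists_jetMul_eq_sum μ
    exact ⟨_, lieDerivAt_eq_of_sum d hχ hμ⟩
  choose lam hlam using key
  have hr : ∀ r : GaugeSec I F E, ∀ m, pairAt (lam m) (r.1 m) =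
      (act d (pair μ r) - pair μ (gaugeBracket d r)) m := fun r m => hlam m r
  refine ⟨⟨lam, fun r hr' => ?_⟩, fun r => ContMDiffSection.ext fun m => hr r m⟩
  -- Smoothness comes for free: each pairing with `𝔯` is a difference of two smooth sections of `E`.
  have h := (act d (pair μ ⟨r, hr'⟩) - pair μ (gaugeBracket d ⟨r, hr'⟩)).contMDiff
  simp only [← hr ⟨r, hr'⟩] at h
  exact h

variable [T2Space M] [FiniteDimensional ℝ F] [ContMDiffVectorBundle ∞ F E I]

theorem gaugeBracket_add_left (hF : 0 < Module.finrank ℝ F) (d d' r : GaugeSec I F E) :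
    gaugeBracket (d + d') r = gaugeBracket d r + gaugeBracket d' r := by
  refine gaugeSec_ext_of_op hF fun m u => ?_
  have h1 : act (d + d') u = act d u + act d' u := rfl
  have h2 : gaugeOp ((d + d').1 m) (act r u) =
    gaugeOp (d.1 m) (act r u) + gaugeOp (d'.1 m) (act r u) := rfl
  have h3 : gaugeOp ((gaugeBracket d r + gaugeBracket d' r).1 m) u =
    gaugeOp ((gaugeBracket d r).1 m) u + gaugeOp ((gaugeBracket d' r).1 m) u := rfl
  rw [h3, gaugeOp_gaugeBracket, gaugeOp_gaugeBracket, gaugeOp_gaugeBracket, h1, h2, map_add]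
  abel

theorem gaugeBracket_smul_left (hF : 0 < Module.finrank ℝ F) (c : ℝ) (d r : GaugeSec I F E) :
    gaugeBracket (c • d) r = c • gaugeBracket d r := by
  refine gaugeSec_ext_of_op hF fun m u => ?_
  have h1 : act (c • d) u = c • act d u := rfl
  have h2 : gaugeOp ((c • d).1 m) (act r u) = c • gaugeOp (d.1 m) (act r u) := rfl
  have h3 : gaugeOp ((c • gaugeBracket d r).1 m) u = c • gaugeOp ((gaugeBracket d r).1 m) u := rfl
  rw [h3, gaugeOp_gaugeBracket, gaugeOp_gaugeBracket, h1, h2, map_smul, smul_sub]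

theorem gaugeBracket_gaugeMul_left (hF : 0 < Module.finrank ℝ F) (f : C^∞⟮I, M; ℝ⟯)
    (d r : GaugeSec I F E) (m : M) :
    (gaugeBracket (gaugeMul f d) r).1 m = f m • (gaugeBracket d r).1 m -
      mvfderiv I f m (gaugeAnchor (r.1 m)) • d.1 m := by
  refine gauge_ext_of_op hF fun u => ?_
  have h1 : act (gaugeMul f d) u = fmul f (act d u) := rfl
  have h2 : gaugeOp ((gaugeMul f d).1 m) (act r u) = f m • gaugeOp (d.1 m) (act r u) := rfl
  have h3 : act d u m = gaugeOp (d.1 m) u := rfl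
  rw [gaugeOp_sub, gaugeOp_smul, gaugeOp_smul, gaugeOp_gaugeBracket, gaugeOp_gaugeBracket, h1, h2,
    gaugeOp_fmul, h3, smul_sub]
  abel

end LieDerivative

/-! ### Graphs of bundle maps: isotropy and maximality -/

namespace JetToGauge

/-- The action of a bundle map `𝔍E → 𝔇E` on sections. -/
def mapSec (φ : JetToGauge I F E) : JetSec I F E →ₗ[ℝ] GaugeSec I F E where
  toFun μ := ⟨fun m => φ.toFun m (μ.1 m), φ.smooth μ.1 μ.2⟩
  map_add' μ ν := Subtype.ext (funext fun m => map_add (φ.toFun m) (μ.1 m) (ν.1 m))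
  map_smul' c μ := Subtype.ext (funext fun m => map_smul (φ.toFun m) c (μ.1 m))

theorem mapSec_apply (φ : JetToGauge I F E) (μ : JetSec I F E) (m : M) :
    (φ.mapSec μ).1 m = φ.toFun m (μ.1 m) := rfl

theorem mapSec_jetMul (φ : JetToGauge I F E) (f : C^∞⟮I, M; ℝ⟯) (μ : JetSec I F E) :
    φ.mapSec (jetMul f μ) = gaugeMul f (φ.mapSec μ) :=
  Subtype.ext (funext fun m => map_smul (φ.toFun m) (f m) (μ.1 m))

theorem mem_graph (φ : JetToGauge I F E) {m : M} {X : Omni I F E m} :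
    X ∈ φ.graph m ↔ X.1 = φ.toFun m X.2 := by
  constructor
  · rintro ⟨μ, rfl⟩
    rfl
  · intro h
    exact ⟨X.2, Prod.ext h.symm rfl⟩

theorem graph_injective {φ ψ : JetToGauge I F E} (h : φ.graph = ψ.graph) :
    φ.toFun = ψ.toFun := by
  funext m
  refine LinearMap.ext fun μ => ?_
  have h1 : ((φ.toFun m μ, μ) : Omni I F E m) ∈ φ.graph m := φ.mem_graph.2 rfl
  rw [h] at h1
  exact ψ.mem_graph.1 h1

theorem isIsotropic_graph_iff (φ : JetToGauge I F E) {m : M} :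
    IsIsotropic (φ.graph m) ↔ ∀ μ ν : Jet I F E m, ν.1 (φ.toFun m μ) + μ.1 (φ.toFun m ν) = 0 := by
  constructor
  · intro h μ ν
    have := h (φ.toFun m μ, μ) (φ.mem_graph.2 rfl) (φ.toFun m ν, ν) (φ.mem_graph.2 rfl)
    exact (smul_eq_zero_iff_right (by norm_num : (1 / 2 : ℝ) ≠ 0)).1 this
  · intro h X hX Y hY
    have := h X.2 Y.2
    rw [← φ.mem_graph.1 hX, ← φ.mem_graph.1 hY] at this
    change (1 / 2 : ℝ) • (Y.2.1 X.1 + X.2.1 Y.1) = 0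
    rw [this, smul_zero]

variable [FiniteDimensional ℝ B] [T2Space M] [FiniteDimensional ℝ F] [ContMDiffVectorBundle ∞ F E I]

theorem isSubbundle_graph (φ : JetToGauge I F E) : IsSubbundle φ.graph := by
  intro m
  obtain ⟨Φ⟩ := exists_jetFrame (I := I) (F := F) (E := E) m
  let σ := (Fintype.equivFin (Fin (Module.finrank ℝ F) ⊕
    (Fin (Module.finrank ℝ F) × Fin (Module.finrank ℝ B)))).symm
  refine ⟨_, fun k => (φ.mapSec (jet (Φ.jetSections (σ k))), jet (Φ.jetSections (σ k))), ?_⟩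
  filter_upwards [Φ.isOpen_dom.mem_nhds Φ.mem_dom] with p hp
  have h : (fun k => omniAt ((φ.mapSec (jet (Φ.jetSections (σ k))),
      jet (Φ.jetSections (σ k))) : OmniSec I F E) p) =
      ((φ.toFun p).prod LinearMap.id) ∘ (fun k => jetAt I F E p (Φ.jetSections k)) ∘ σ := rfl
  rw [h]
  constructor
  · refine LinearIndependent.map' ((Φ.linearIndependent_jetSections hp).comp σ σ.injective) _ ?_
    exact LinearMap.ker_eq_bot.2 fun μ ν hμν => congrArg Prod.snd hμν
  · rw [Set.range_comp, σ.surjective.range_comp, Submodule.span_image, Φ.span_jetSections hp,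
      Submodule.map_top]
    rfl

/-- Subtracting from `X` the graph point over its jet component leaves some `(δ, 0)` in the larger
isotropic space. Pairing it with the graph point over `𝕕u` gives `δ u = 0` for every `u`. -/
theorem maximal_graph (hF : 0 < Module.finrank ℝ F) (φ : JetToGauge I F E) {m : M}
    (h : IsIsotropic (φ.graph m)) : Maximal IsIsotropic (φ.graph m) := by
  refine ⟨h, fun L hL hle X hX => ?_⟩
  rw [mem_graph]
  refine gauge_ext_of_op hF fun u => ?_
  have h1 : ((φ.toFun m X.2, X.2) : Omni I F E m) ∈ L := hle (φ.mem_graph.2 rfl)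
  have h2 : ((φ.toFun m (jetAt I F E m u), jetAt I F E m u) : Omni I F E m) ∈ L :=
    hle (φ.mem_graph.2 rfl)
  have h3 : omniPairing (X - (φ.toFun m X.2, X.2)) _ = 0 := hL _ (L.sub_mem hX h1) _ h2
  have h4 := (smul_eq_zero_iff_right (by norm_num : (1 / 2 : ℝ) ≠ 0)).1 h3
  change gaugeOp (X.1 - φ.toFun m X.2) u +
    (X.2 - X.2).1 (φ.toFun m (jetAt I F E m u)) = 0 at h4
  rw [sub_self] at h4
  change gaugeOp (X.1 - φ.toFun m X.2) u + 0 = 0 at h4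
  rw [add_zero, gaugeOp_sub] at h4
  exact sub_eq_zero.1 h4

end JetToGauge

/-! ### From Lie algebroids to Dirac structures -/

namespace LieAlgebroid

variable (A : LieAlgebroid I F E)

theorem bracket_skew (u v : Sec I F E) : A.bracket u v = -A.bracket v u := by
  have h := A.bracket_self (u + v)
  simp only [map_add, LinearMap.add_apply, A.bracket_self, zero_add, add_zero] at h
  exact eq_neg_of_add_eq_zero_right h

/-- The adjoint operator `[u, ·]`, as a section of `𝔇E`. -/
def ad (u : Sec I F E) : GaugeSec I F E :=
  ⟨fun m => ⟨(evalAt I F E m ∘ₗ A.bracket u, A.anchor m (u m)), fun f v => A.leibniz u v f m⟩,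
    fun v => (A.bracket u v).contMDiff, A.smooth_anchor.comp u.contMDiff⟩

theorem gaugeOp_ad (u v : Sec I F E) (m : M) : gaugeOp ((A.ad u).1 m) v = A.bracket u v m := rfl

theorem act_ad (u v : Sec I F E) : act (A.ad u) v = A.bracket u v := rfl

theorem ad_add (u v : Sec I F E) (m : M) :
    (A.ad (u + v)).1 m = (A.ad u).1 m + (A.ad v).1 m :=
  gauge_ext (fun w => congrArg (fun s : Sec I F E →ₗ[ℝ] Sec I F E => s w m)
    (map_add A.bracket u v)) (map_add (A.anchor m) (u m) (v m))

theorem ad_smul (c : ℝ) (u : Sec I F E) (m : M) : (A.ad (c • u)).1 m = c • (A.ad u).1 m :=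
  gauge_ext (fun w => congrArg (fun s : Sec I F E →ₗ[ℝ] Sec I F E => s w m)
    (map_smul A.bracket c u)) (map_smul (A.anchor m) c (u m))

/-- By skew-symmetry and Leibniz, `[f u, w] = f [u, w] - (ρ(w) f) u`; the last term is tensorial in
`w`, hence an endomorphism. -/
theorem ad_fmul (f : C^∞⟮I, M; ℝ⟯) (u : Sec I F E) (m : M) :
    (A.ad (fmul f u)).1 m = f m • (A.ad u).1 m -
      gaugeOfEnd (((mvfderiv I f m : TangentSpace I m →ₗ[ℝ] ℝ) ∘ₗ A.anchor m).smulRight (u m)) := by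
  refine gauge_ext (fun w => ?_) ?_
  · rw [gaugeOp_sub, gaugeOp_smul, gaugeOp_ad, gaugeOp_ad, A.bracket_skew, A.bracket_skew u w]
    change -(A.bracket w (fmul f u) m) = f m • (-(A.bracket w u m)) -
      mvfderiv I f m (A.anchor m (w m)) • u m
    rw [A.leibniz, smul_neg, neg_add, sub_eq_add_neg]
  · change A.anchor m (f m • u m) = f m • A.anchor m (u m) - 0
    rw [map_smul, sub_zero]

/-- The bundle map `𝔍E → 𝔇E` of a Lie algebroid, with `𝕕u ↦ [u, ·]`. -/
def toJetToGauge : JetToGauge I F E where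
  toFun m :=
    -- Isotropy forces this formula: `π(μ) v = ⟨𝕕v, π μ⟩ = -⟨μ, π(𝕕v)⟩`.
    { toFun := fun μ => ⟨({ toFun := fun v => -μ.1 ((A.ad v).1 m)
                            map_add' := fun u v => by rw [ad_add, map_add, neg_add]
                            map_smul' := fun c u => by
                              rw [ad_smul, map_smul, smul_neg, RingHom.id_apply] },
          A.anchor m (μ.1 ((gaugeOne I F E).1 m))), fun f u => by
            change -μ.1 ((A.ad (fmul f u)).1 m) = f m • -μ.1 ((A.ad u).1 m) +
              mvfderiv I f m (A.anchor m (μ.1 ((gaugeOne I F E).1 m))) • u m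
            -- The jet condition evaluates `μ` on the endomorphism `w ↦ (ρ(w) f) u` as `(ρ(μ(1)) f)
            -- u`, which dictates the anchor.
            rw [ad_fmul, map_sub, map_smul, μ.2, neg_sub, smul_neg, neg_add_eq_sub]
            rfl⟩
      map_add' := fun μ ν => gauge_ext
        (fun u => neg_add (μ.1 ((A.ad u).1 m)) (ν.1 ((A.ad u).1 m))) (map_add (A.anchor m) _ _)
      map_smul' := fun c μ => gauge_ext
        (fun u => (smul_neg c (μ.1 ((A.ad u).1 m))).symm) (map_smul (A.anchor m) _ _) }
  smooth μ hμ := ⟨fun u => (-pair ⟨μ, hμ⟩ (A.ad u)).contMDiff,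
    A.smooth_anchor.comp (pair ⟨μ, hμ⟩ (gaugeOne I F E)).contMDiff⟩

theorem gaugeOp_toJetToGauge {m : M} (μ : Jet I F E m) (u : Sec I F E) :
    gaugeOp (A.toJetToGauge.toFun m μ) u = -μ.1 ((A.ad u).1 m) := rfl

theorem toJetToGauge_jetAt (u : Sec I F E) (m : M) :
    A.toJetToGauge.toFun m (jetAt I F E m u) = (A.ad u).1 m := by
  refine gauge_ext (fun v => ?_) rfl
  rw [gaugeOp_toJetToGauge, jetAt_apply, gaugeOp_ad, gaugeOp_ad, A.bracket_skew u v]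
  rfl

theorem mapSec_jet (u : Sec I F E) : A.toJetToGauge.mapSec (jet u) = A.ad u :=
  Subtype.ext (funext fun m => A.toJetToGauge_jetAt u m)

variable [FiniteDimensional ℝ B] [T2Space M] [FiniteDimensional ℝ F] [ContMDiffVectorBundle ∞ F E I]

theorem pairing_skew {m : M} (μ ν : Jet I F E m) :
    ν.1 (A.toJetToGauge.toFun m μ) + μ.1 (A.toJetToGauge.toFun m ν) = 0 := by
  obtain ⟨u, rfl⟩ := exists_jetAt_eq μ
  obtain ⟨v, rfl⟩ := exists_jetAt_eq ν
  rw [toJetToGauge_jetAt, toJetToGauge_jetAt, jetAt_apply, jetAt_apply, gaugeOp_ad, gaugeOp_ad,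
    A.bracket_skew u v]
  exact neg_add_cancel (A.bracket v u m)

theorem pair_mapSec_skew (μ ν : JetSec I F E) :
    pair ν (A.toJetToGauge.mapSec μ) = -pair μ (A.toJetToGauge.mapSec ν) :=
  ContMDiffSection.ext fun m => eq_neg_of_add_eq_zero_left (A.pairing_skew (μ.1 m) (ν.1 m))

/-- The defect of the Jacobi identity in
`⟨ν, [π μ, [w, ·]]⟩ - ⟨μ, [π ν, [w, ·]]⟩ = [w, ⟨μ, π ν⟩]`, as a function of `μ`. -/
def jacobiDefect (hF : 0 < Module.finrank ℝ F) (ν : JetSec I F E) (w : Sec I F E) (m : M) :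
    JetSec I F E →ₗ[ℝ] E m :=
  (ν.1 m).1 ∘ₗ ({ toFun := fun μ => (gaugeBracket (A.toJetToGauge.mapSec μ) (A.ad w)).1 m
                  map_add' := fun μ μ' => by
                    rw [map_add, gaugeBracket_add_left hF]
                    rfl
                  map_smul' := fun c μ => by
                    rw [map_smul, gaugeBracket_smul_left hF]
                    rfl } : JetSec I F E →ₗ[ℝ] Gauge I F E m) -
    pairLeftAt ((gaugeBracket (A.toJetToGauge.mapSec ν) (A.ad w)).1 m) -
    gaugeOp ((A.ad w).1 m) ∘ₗ pairLeft (A.toJetToGauge.mapSec ν)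

theorem jacobiDefect_apply (hF : 0 < Module.finrank ℝ F) (μ ν : JetSec I F E) (w : Sec I F E)
    (m : M) : A.jacobiDefect hF ν w m μ =
      (ν.1 m).1 ((gaugeBracket (A.toJetToGauge.mapSec μ) (A.ad w)).1 m) -
      (μ.1 m).1 ((gaugeBracket (A.toJetToGauge.mapSec ν) (A.ad w)).1 m) -
      gaugeOp ((A.ad w).1 m) (pair μ (A.toJetToGauge.mapSec ν)) := rfl

theorem jacobiDefect_skew (hF : 0 < Module.finrank ℝ F) (μ ν : JetSec I F E) (w : Sec I F E)
    (m : M) : A.jacobiDefect hF ν w m μ = -A.jacobiDefect hF μ w m ν := by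
  have h : gaugeOp ((A.ad w).1 m) (pair ν (A.toJetToGauge.mapSec μ)) =
      -gaugeOp ((A.ad w).1 m) (pair μ (A.toJetToGauge.mapSec ν)) :=
    (congrArg _ (A.pair_mapSec_skew μ ν)).trans (map_neg _ _)
  simp only [jacobiDefect_apply, h]
  abel

/-- Two derivative terms appear, `-(ρ(w) f) ⟨ν, π μ⟩` from the bracket and `-(ρ(w) f) ⟨μ, π ν⟩` from
`[w, ·]`; they cancel by isotropy. -/
theorem jacobiDefect_jetMul (hF : 0 < Module.finrank ℝ F) (f : C^∞⟮I, M; ℝ⟯) (μ ν : JetSec I F E)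
    (w : Sec I F E) (m : M) :
    A.jacobiDefect hF ν w m (jetMul f μ) = f m • A.jacobiDefect hF ν w m μ := by
  have h1 : pair (jetMul f μ) (A.toJetToGauge.mapSec ν) =
    fmul f (pair μ (A.toJetToGauge.mapSec ν)) := rfl
  have h2 : ∀ δ, ((jetMul f μ).1 m).1 δ = f m • (μ.1 m).1 δ := fun _ => rfl
  have h3 : pair μ (A.toJetToGauge.mapSec ν) m = (μ.1 m).1 (A.toJetToGauge.toFun m (ν.1 m)) := rfl
  have h4 := eq_neg_of_add_eq_zero_left (A.pairing_skew (μ.1 m) (ν.1 m))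
  simp only [jacobiDefect_apply, JetToGauge.mapSec_jetMul, gaugeBracket_gaugeMul_left hF, map_sub,
    map_smul, h1, h2, gaugeOp_fmul, h3, JetToGauge.mapSec_apply, h4, smul_neg, smul_sub]
  abel

/-- On one-jets the defect is the Jacobiator of `u, w, v`. -/
theorem jacobiDefect_jet_jet (hF : 0 < Module.finrank ℝ F) (u v w : Sec I F E) (m : M) :
    A.jacobiDefect hF (jet v) w m (jet u) = 0 := by
  rw [jacobiDefect_apply, mapSec_jet, mapSec_jet]
  change gaugeOp ((gaugeBracket (A.ad u) (A.ad w)).1 m) v -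
    gaugeOp ((gaugeBracket (A.ad v) (A.ad w)).1 m) u - gaugeOp ((A.ad w).1 m) (act (A.ad v) u) = 0
  simp only [gaugeOp_gaugeBracket, act_ad, gaugeOp_ad]
  have h := congrArg (evalAt I F E m) (A.jacobi u w v)
  rw [map_add, map_add, map_zero] at h
  change A.bracket u (A.bracket w v) m + A.bracket w (A.bracket v u) m +
    A.bracket v (A.bracket u w) m = 0 at h
  have h1 : A.bracket w (A.bracket u v) m = -A.bracket w (A.bracket v u) m := by
    rw [A.bracket_skew u v, map_neg]
    rfl
  have h2 : A.bracket v (A.bracket w u) m = -A.bracket v (A.bracket u w) m := by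
    rw [A.bracket_skew w u, map_neg]
    rfl
  rw [h1, h2, ← h]
  abel

theorem jacobiDefect_eq_zero (hF : 0 < Module.finrank ℝ F) (μ ν : JetSec I F E) (w : Sec I F E)
    (m : M) : A.jacobiDefect hF ν w m μ = 0 := by
  refine eq_zero_of_jet _ (fun f μ => A.jacobiDefect_jetMul hF f μ ν w m) (fun u => ?_) μ
  -- With `μ` reduced to a one-jet, skewness moves `ν` into the tensorial slot for the second
  -- reduction.
  rw [jacobiDefect_skew, neg_eq_zero]
  exact eq_zero_of_jet _ (fun f μ => A.jacobiDefect_jetMul hF f μ (jet u) w m)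
    (fun v => A.jacobiDefect_jet_jet hF v u w m) ν

/-- Applied to `w`, the right side is the commutator of `π μ` and `π ν` plus the Jacobi defect,
since `⟨κ, [w, ·]⟩ = -π(κ) w`. -/
theorem toJetToGauge_lieDerivative (hF : 0 < Module.finrank ℝ F) {μ ν lam₁ lam₂ : JetSec I F E}
    (h₁ : IsLieDerivative (A.toJetToGauge.mapSec μ) ν lam₁)
    (h₂ : IsLieDerivative (A.toJetToGauge.mapSec ν) μ lam₂) (m : M) :
    (gaugeBracket (A.toJetToGauge.mapSec μ) (A.toJetToGauge.mapSec ν)).1 m =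
      A.toJetToGauge.toFun m
        (lam₁.1 m - lam₂.1 m + jetAt I F E m (pair μ (A.toJetToGauge.mapSec ν))) := by
  refine gauge_ext_of_op hF fun w => ?_
  have e₁ : (lam₁.1 m).1 ((A.ad w).1 m) =
      lieDerivAt (A.toJetToGauge.mapSec μ) (A.ad w) m ν :=
    h₁.apply (A.ad w) m
  have e₂ : (lam₂.1 m).1 ((A.ad w).1 m) =
      lieDerivAt (A.toJetToGauge.mapSec ν) (A.ad w) m μ :=
    h₂.apply (A.ad w) m
  have e₃ : ∀ κ : JetSec I F E, pair κ (A.ad w) = -act (A.toJetToGauge.mapSec κ) w := fun κ =>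
    ContMDiffSection.ext fun p => (neg_neg ((κ.1 p).1 ((A.ad w).1 p))).symm
  have e₄ := A.jacobiDefect_eq_zero hF μ ν w m
  simp only [jacobiDefect_apply] at e₄
  simp only [lieDerivAt_apply, e₃, map_neg] at e₁ e₂
  simp only [gaugeOp_toJetToGauge, Submodule.coe_add, Submodule.coe_sub, LinearMap.add_apply,
    LinearMap.sub_apply, jetAt_apply, e₁, e₂, ← sub_eq_zero.1 e₄, gaugeOp_gaugeBracket]
  abel

set_option maxHeartbeats 1000000 in
theorem isDirac_graph (hF : 0 < Module.finrank ℝ F) : IsDirac A.toJetToGauge.graph where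
  subbundle := A.toJetToGauge.isSubbundle_graph
  maximal_isotropic _ := A.toJetToGauge.maximal_graph hF
    (A.toJetToGauge.isIsotropic_graph_iff.2 A.pairing_skew)
  closed := by
    rintro ⟨d, μ⟩ ⟨r, ν⟩ hX hY
    obtain rfl : d = A.toJetToGauge.mapSec μ :=
      Subtype.ext (funext fun m => A.toJetToGauge.mem_graph.1 (hX m))
    obtain rfl : r = A.toJetToGauge.mapSec ν :=
      Subtype.ext (funext fun m => A.toJetToGauge.mem_graph.1 (hY m))
    obtain ⟨lam₁, h₁⟩ := exists_isLieDerivative (A.toJetToGauge.mapSec μ) ν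
    obtain ⟨lam₂, h₂⟩ := exists_isLieDerivative (A.toJetToGauge.mapSec ν) μ
    exact ⟨_, ⟨lam₁, lam₂, h₁, h₂, rfl⟩, fun m =>
      A.toJetToGauge.mem_graph.2 (A.toJetToGauge_lieDerivative hF h₁ h₂ m)⟩

end LieAlgebroid

/-! ### The anchor in rank at least two -/

section Anchor

theorem finrank_fiber [FiniteDimensional ℝ F] (m : M) :
    Module.finrank ℝ (E m) = Module.finrank ℝ F :=
  LinearEquiv.finrank_eq ((trivializationAt F E m).linearEquivAt ℝ m
    (mem_baseSet_trivializationAt F E m))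

variable [FiniteDimensional ℝ B] [T2Space M] [FiniteDimensional ℝ F] [ContMDiffVectorBundle ∞ F E I]

/-- In rank at least two, the anchor of a skew-symmetric bracket of first order is tensorial. -/
theorem anchor_fmul_of_skew (hF : 2 ≤ Module.finrank ℝ F) {m : M}
    (D : Sec I F E →ₗ[ℝ] Gauge I F E m) (hD : ∀ u v, gaugeOp (D u) v = -gaugeOp (D v) u)
    (f : C^∞⟮I, M; ℝ⟯) (u : Sec I F E) :
    gaugeAnchor (D (fmul f u)) = f m • gaugeAnchor (D u) := by
  have key : ∀ u : Sec I F E, u m ≠ 0 →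
      gaugeAnchor (D (fmul f u)) = f m • gaugeAnchor (D u) := by
    intro u hu
    obtain ⟨y, hy⟩ := exists_linearIndependent_pair_of_one_lt_finrank (R := ℝ)
      (by rw [finrank_fiber (F := F)]; omega : 1 < Module.finrank ℝ (E m)) hu
    obtain ⟨v, rfl⟩ := exists_sec_eq (I := I) (F := F) y
    refine tangent_ext fun g => ?_
    -- The operator value `D(f u)(g v)` is expanded twice, here by Leibniz in `g` first and in `h2`
    -- after exchanging the arguments; the difference is a relation between `u m` and `v m`.
    have h1 : gaugeOp (D (fmul f u)) (fmul g v) =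
        g m • -(f m • gaugeOp (D v) u + mvfderiv I f m (gaugeAnchor (D v)) • u m) +
          mvfderiv I g m (gaugeAnchor (D (fmul f u))) • v m := by
      rw [gaugeOp_fmul, hD (fmul f u) v, gaugeOp_fmul]
    have h2 : gaugeOp (D (fmul f u)) (fmul g v) =
        -(f m • -(g m • -gaugeOp (D v) u + mvfderiv I g m (gaugeAnchor (D u)) • v m) +
          mvfderiv I f m (gaugeAnchor (D (fmul g v))) • u m) := by
      rw [hD, gaugeOp_fmul, hD (fmul g v) u, gaugeOp_fmul, hD u v]
    have h3 : (mvfderiv I f m (gaugeAnchor (D (fmul g v))) -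
          g m * mvfderiv I f m (gaugeAnchor (D v))) • u m +
        (mvfderiv I g m (gaugeAnchor (D (fmul f u))) -
          f m * mvfderiv I g m (gaugeAnchor (D u))) • v m = 0 := by
      rw [h1] at h2
      rw [← sub_eq_zero] at h2
      rw [← h2]
      module
    have h4 := (LinearIndependent.pair_iff.1 hy _ _ h3).2
    rw [map_smul, smul_eq_mul]
    exact sub_eq_zero.1 h4
  -- A section vanishing at `m` is the difference of `u + v` and `v`, neither of which vanishes
  -- there, and the claim is additive.
  by_cases hu : u m = 0
  · have : Nontrivial (E m) := Module.nontrivial_of_finrank_pos (R := ℝ)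
      (by rw [finrank_fiber (F := F)]; omega)
    obtain ⟨y, hy⟩ := exists_ne (0 : E m)
    obtain ⟨v, rfl⟩ := exists_sec_eq (I := I) (F := F) y
    have h1 : fmul f (u + v) = fmul f u + fmul f v :=
      ContMDiffSection.ext fun p => smul_add (f p) (u p) (v p)
    have hadd : ∀ a b : Sec I F E,
        gaugeAnchor (D (a + b)) = gaugeAnchor (D a) + gaugeAnchor (D b) := fun a b =>
      congrArg gaugeAnchor (map_add D a b)
    have h2 := key (u + v) (by
      change u m + v m ≠ 0
      rwa [hu, zero_add])
    rw [h1, hadd, hadd, key v hy, smul_add] at h2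
    exact add_right_cancel h2
  · exact key u hu

/-- A fibrewise linear map which sends smooth sections to smooth vector fields is smooth. -/
theorem contMDiff_of_sec (a : Π m : M, E m →ₗ[ℝ] TangentSpace I m)
    (ha : ∀ u : Sec I F E,
      ContMDiff I I.tangent ∞ (fun m => (⟨m, a m (u m)⟩ : TangentBundle I M))) :
    ContMDiff (I.prod 𝓘(ℝ, F)) I.tangent ∞
      (fun v : TotalSpace F E => (⟨v.1, a v.1 v.2⟩ : TangentBundle I M)) := by
  intro v
  obtain ⟨Φ⟩ := exists_jetFrame (I := I) (F := F) (E := E) v.1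
  have hproj : ContMDiff (I.prod 𝓘(ℝ, F)) I ∞ (TotalSpace.proj : TotalSpace F E → M) :=
    Bundle.contMDiff_proj E
  set t := trivializationAt B (TangentSpace I : M → Type _) v.1 with ht
  refine Bundle.contMDiffAt_totalSpace.2 ⟨hproj.contMDiffAt, ?_⟩
  have h1 : ∀ i, ContMDiffAt (I.prod 𝓘(ℝ, F)) 𝓘(ℝ, B) ∞
      (fun w : TotalSpace F E => Φ.coeff i w.1 w.2 •
        (t (⟨w.1, a w.1 (Φ.sec i w.1)⟩ : TangentBundle I M)).2) v := fun i =>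
    (Φ.smooth_coeff i).contMDiffAt.smul
      (Bundle.contMDiffAt_totalSpace.1 ((ha (Φ.sec i)).comp hproj).contMDiffAt).2
  -- Near the base point the map is `∑ εᵢ(w) a(eᵢ)`, with `εᵢ` smooth on the total space.
  refine (ContMDiffAt.sum (t := Finset.univ) fun i _ => h1 i).congr_of_eventuallyEq ?_
  have hb : t.baseSet ∈ 𝓝 v.1 :=
    t.open_baseSet.mem_nhds (mem_baseSet_trivializationAt B (TangentSpace I : M → Type _) v.1)
  filter_upwards [hproj.continuous.continuousAt.preimage_mem_nhds hb,
    hproj.continuous.continuousAt.preimage_mem_nhds (Φ.isOpen_dom.mem_nhds Φ.mem_dom)] with w hw hw'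
  have h2 : ∀ x : TangentSpace I w.1, (t (⟨w.1, x⟩ : TangentBundle I M)).2 =
      t.linearMapAt ℝ w.1 x := fun x => by
    rw [Trivialization.coe_linearMapAt_of_mem _ hw]
  have h3 : a w.1 w.2 = ∑ i, Φ.coeff i w.1 w.2 • a w.1 (Φ.sec i w.1) := by
    conv_lhs => rw [← Φ.sum_coeff w.1 hw' w.2, map_sum]
    simp only [map_smul]
  change (t (⟨w.1, a w.1 w.2⟩ : TangentBundle I M)).2 = _
  rw [h2, h3, map_sum]
  simp only [map_smul, h2]

end Anchor

/-! ### From Dirac graphs to Lie algebroids -/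

namespace JetToGauge

variable {φ : JetToGauge I F E}

variable (φ) in
/-- The bracket `[u, v] = φ(𝕕u) v` on `Γ(E)`. -/
def bracket : Sec I F E →ₗ[ℝ] Sec I F E →ₗ[ℝ] Sec I F E :=
  LinearMap.mk₂ ℝ (fun u v => act (φ.mapSec (jet u)) v)
    (fun u u' v => ContMDiffSection.ext fun m => by
      change gaugeOp (φ.toFun m (jetAt I F E m (u + u'))) v = _
      rw [map_add, map_add]
      rfl)
    (fun c u v => ContMDiffSection.ext fun m => by
      change gaugeOp (φ.toFun m (jetAt I F E m (c • u))) v = _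
      rw [map_smul, map_smul]
      rfl)
    (fun u v v' => map_add _ v v') (fun c u v => map_smul _ c v)

theorem bracket_apply (u v : Sec I F E) (m : M) :
    φ.bracket u v m = gaugeOp (φ.toFun m (jetAt I F E m u)) v := rfl

theorem gaugeOp_mapSec_jet (u v : Sec I F E) (m : M) :
    gaugeOp ((φ.mapSec (jet u)).1 m) v = φ.bracket u v m := rfl

theorem act_mapSec_jet (u v : Sec I F E) : act (φ.mapSec (jet u)) v = φ.bracket u v := rfl

section Dirac

variable [FiniteDimensional ℝ B]

theorem pairing_skew_of_isDirac (h : IsDirac φ.graph) {m : M} (μ ν : Jet I F E m) :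
    ν.1 (φ.toFun m μ) = -μ.1 (φ.toFun m ν) :=
  eq_neg_of_add_eq_zero_left (φ.isIsotropic_graph_iff.1 (h.maximal_isotropic m).1 μ ν)

theorem gaugeOp_eq_neg_of_isDirac (h : IsDirac φ.graph) {m : M} (μ : Jet I F E m)
    (u : Sec I F E) : gaugeOp (φ.toFun m μ) u = -μ.1 (φ.toFun m (jetAt I F E m u)) :=
  pairing_skew_of_isDirac h μ (jetAt I F E m u)

theorem bracket_skew_of_isDirac (h : IsDirac φ.graph) (u v : Sec I F E) :
    φ.bracket u v = -φ.bracket v u :=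
  ContMDiffSection.ext fun m => gaugeOp_eq_neg_of_isDirac h (jetAt I F E m u) v

theorem bracket_self_of_isDirac (h : IsDirac φ.graph) (u : Sec I F E) : φ.bracket u u = 0 := by
  have h1 : (2 : ℝ) • φ.bracket u u = 0 := by
    rw [two_smul]
    exact eq_neg_iff_add_eq_zero.1 (bracket_skew_of_isDirac h u u)
  exact (smul_eq_zero_iff_right two_ne_zero).1 h1

theorem exists_gaugeBracket_eq_of_isDirac (h : IsDirac φ.graph) (u v : Sec I F E) :
    ∃ lam₁ lam₂ : JetSec I F E, IsLieDerivative (φ.mapSec (jet u)) (jet v) lam₁ ∧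
      IsLieDerivative (φ.mapSec (jet v)) (jet u) lam₂ ∧
      ∀ m, (gaugeBracket (φ.mapSec (jet u)) (φ.mapSec (jet v))).1 m =
        φ.toFun m (lam₁.1 m - lam₂.1 m + jetAt I F E m (φ.bracket v u)) := by
  obtain ⟨Z, ⟨lam₁, lam₂, h₁, h₂, rfl⟩, hZ⟩ := h.closed (φ.mapSec (jet u), jet u)
    (φ.mapSec (jet v), jet v) (fun m => φ.mem_graph.2 rfl) fun m => φ.mem_graph.2 rfl
  exact ⟨lam₁, lam₂, h₁, h₂, fun m => φ.mem_graph.1 (hZ m)⟩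

/-- The jet component of the Dorfman bracket of the graph points over `𝕕u` and `𝕕v` pairs with
`π(𝕕w)` to `[w, [u, v]]`. Closure and isotropy then identify `[u, [v, w]] - [v, [u, w]]` with `-[w,
[u, v]]`. -/
theorem jacobi_of_isDirac (h : IsDirac φ.graph) (u v w : Sec I F E) :
    φ.bracket u (φ.bracket v w) + φ.bracket v (φ.bracket w u) + φ.bracket w (φ.bracket u v) =
      0 := by
  obtain ⟨lam₁, lam₂, h₁, h₂, hZ⟩ := exists_gaugeBracket_eq_of_isDirac h u v
  refine ContMDiffSection.ext fun m => ?_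
  have e₁ := h₁.apply (φ.mapSec (jet w)) m
  have e₂ := h₂.apply (φ.mapSec (jet w)) m
  have e₃ := gaugeOp_eq_neg_of_isDirac h
    (lam₁.1 m - lam₂.1 m + jetAt I F E m (φ.bracket v u)) w
  rw [← hZ m] at e₃
  simp only [lieDerivAt_jet, mapSec_apply] at e₁ e₂
  have e₄ : ∀ a, φ.toFun m ((jet a).1 m) = φ.toFun m (jetAt I F E m a) := fun _ => rfl
  simp only [e₄] at e₁ e₂
  simp only [gaugeOp_gaugeBracket, Submodule.coe_add, Submodule.coe_sub, LinearMap.add_apply,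
    LinearMap.sub_apply, jetAt_apply, e₁, e₂, act_mapSec_jet, ← bracket_apply,
    gaugeOp_mapSec_jet, sub_add_cancel] at e₃
  have e₅ : φ.bracket v (φ.bracket w u) m = -φ.bracket v (φ.bracket u w) m := by
    rw [bracket_skew_of_isDirac h w u, map_neg]
    rfl
  change φ.bracket u (φ.bracket v w) m + φ.bracket v (φ.bracket w u) m +
    φ.bracket w (φ.bracket u v) m = 0
  rw [e₅, ← sub_eq_add_neg, e₃, neg_add_cancel]

end Dirac

variable [FiniteDimensional ℝ B] [T2Space M] [FiniteDimensional ℝ F] [ContMDiffVectorBundle ∞ F E I]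

theorem exists_anchor (hF : 2 ≤ Module.finrank ℝ F) (h : IsDirac φ.graph) (m : M) :
    ∃ a : E m →ₗ[ℝ] TangentSpace I m,
      ∀ u : Sec I F E, gaugeAnchor (φ.toFun m (jetAt I F E m u)) = a (u m) := by
  obtain ⟨Φ⟩ := exists_jetFrame (I := I) (F := F) (E := E) m
  let T : Sec I F E →ₗ[ℝ] TangentSpace I m :=
    { toFun := fun u => gaugeAnchor (φ.toFun m (jetAt I F E m u))
      map_add' := fun u v => by rw [map_add, map_add]; rfl
      map_smul' := fun c u => by rw [map_smul, map_smul]; rfl }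
  have hT : ∀ (f : C^∞⟮I, M; ℝ⟯) (u : Sec I F E), T (fmul f u) = f m • T u :=
    anchor_fmul_of_skew hF (φ.toFun m ∘ₗ jetAt I F E m) fun u v =>
      gaugeOp_eq_neg_of_isDirac h (jetAt I F E m u) v
  refine ⟨∑ i, (Φ.coeff i m).smulRight (T (Φ.sec i)), fun u => ?_⟩
  rw [LinearMap.sum_apply]
  exact Φ.eq_sum_of_tensorial Φ.mem_dom T hT u

variable (φ) in
/-- The Lie algebroid of a Dirac graph, for a given anchor. -/
def lieAlgebroid (h : IsDirac φ.graph) (a : Π m : M, E m →ₗ[ℝ] TangentSpace I m)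
    (ha : ∀ (m : M) (u : Sec I F E), gaugeAnchor (φ.toFun m (jetAt I F E m u)) = a m (u m)) :
    LieAlgebroid I F E where
  anchor := a
  smooth_anchor := contMDiff_of_sec a fun u => by
    simp only [← ha]
    exact (φ.mapSec (jet u)).2.2
  bracket := φ.bracket
  bracket_self := bracket_self_of_isDirac h
  jacobi := jacobi_of_isDirac h
  leibniz u v f m := by
    rw [← ha, bracket_apply, bracket_apply]
    exact gaugeOp_fmul (φ.toFun m (jetAt I F E m u)) f v

theorem exists_lieAlgebroid (hF : 2 ≤ Module.finrank ℝ F) (h : IsDirac φ.graph) :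
    ∃ A : LieAlgebroid I F E, A.toJetToGauge.graph = φ.graph := by
  choose a ha using exists_anchor hF h
  refine ⟨φ.lieAlgebroid h a ha, funext fun m => ?_⟩
  have h1 : ∀ v, ((φ.lieAlgebroid h a ha).ad v).1 m = φ.toFun m (jetAt I F E m v) := fun v =>
    gauge_ext (fun _ => rfl) (ha m v).symm
  -- Both maps have the same values on one-jets, and isotropy recovers each from those values.
  have h2 : (φ.lieAlgebroid h a ha).toJetToGauge.toFun m = φ.toFun m := LinearMap.ext fun μ =>
    gauge_ext_of_op (by omega) fun v => by
      rw [LieAlgebroid.gaugeOp_toJetToGauge, h1, gaugeOp_eq_neg_of_isDirac h]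
  rw [graph, graph, h2]

end JetToGauge

/-! ### The correspondence -/

/-- The graph determines `π(𝕕u) = [u, ·]` together with its anchor `ρ(u)`, and every vector of `E`
is the value of a section. -/
theorem LieAlgebroid.graph_injective [FiniteDimensional ℝ B] [T2Space M] [FiniteDimensional ℝ F]
    [ContMDiffVectorBundle ∞ F E I] {A A' : LieAlgebroid I F E}
    (h : A.toJetToGauge.graph = A'.toJetToGauge.graph) : A = A' := by
  have h1 : ∀ u m, (A.ad u).1 m = (A'.ad u).1 m := fun u m => by
    rw [← toJetToGauge_jetAt, ← toJetToGauge_jetAt, JetToGauge.graph_injective h]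
  refine LieAlgebroid.ext (funext fun m => LinearMap.ext fun v => ?_)
    (LinearMap.ext fun u => LinearMap.ext fun v => ContMDiffSection.ext fun m => ?_)
  · obtain ⟨u, rfl⟩ := exists_sec_eq (I := I) (F := F) v
    exact congrArg gaugeAnchor (h1 u m)
  · exact congrArg (fun δ => gaugeOp δ v) (h1 u m)

end OmniLie

end

theorem mainTheorem1
    {B : Type*} [NormedAddCommGroup B] [NormedSpace ℝ B] [FiniteDimensional ℝ B]
    {H : Type*} [TopologicalSpace H] (I : ModelWithCorners ℝ B H) [I.Boundaryless]
    {M : Type*} [TopologicalSpace M] [ChartedSpace H M] [IsManifold I ∞ M]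
    [T2Space M] [SigmaCompactSpace M]
    (F : Type*) [NormedAddCommGroup F] [NormedSpace ℝ F] [FiniteDimensional ℝ F]
    (E : M → Type*) [TopologicalSpace (TotalSpace F E)]
    [∀ m, AddCommGroup (E m)] [∀ m, Module ℝ (E m)] [∀ m, TopologicalSpace (E m)]
    [FiberBundle F E] [VectorBundle ℝ F E] [ContMDiffVectorBundle ∞ F E I]
    (hrank : 2 ≤ Module.finrank ℝ F) :
    ∃ Θ : OmniLie.LieAlgebroid I F E ≃
        {L : Π m : M, Submodule ℝ (OmniLie.Omni I F E m) //
          OmniLie.IsDirac L ∧ ∃ φ : OmniLie.JetToGauge I F E, L = φ.graph},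
      ∀ A : OmniLie.LieAlgebroid I F E, ∃ φ : OmniLie.JetToGauge I F E,
        (Θ A).1 = φ.graph ∧
        ∀ (u : OmniLie.Sec I F E) (m : M),
          (∀ v : OmniLie.Sec I F E,
            OmniLie.gaugeOp (φ.toFun m ((OmniLie.jet u).1 m)) v = A.bracket u v m) ∧
          OmniLie.gaugeAnchor (φ.toFun m ((OmniLie.jet u).1 m)) = A.anchor m (u m) := by
  have hF : 0 < Module.finrank ℝ F := by omega
  refine ⟨Equiv.ofBijective
    (fun A => ⟨A.toJetToGauge.graph, A.isDirac_graph hF, A.toJetToGauge, rfl⟩)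
    ⟨fun A A' h => OmniLie.LieAlgebroid.graph_injective (congrArg Subtype.val h), ?_⟩,
    -- The anchor identity is definitional, as `⟨𝕕u, 1⟩` is `u m`.
    fun A => ⟨A.toJetToGauge, rfl, fun u m => ⟨fun v => ?_, rfl⟩⟩⟩
  · rintro ⟨_, h, φ, rfl⟩
    obtain ⟨A, hA⟩ := OmniLie.JetToGauge.exists_lieAlgebroid hrank h
    exact ⟨A, Subtype.ext hA⟩
  · exact congrArg (fun δ => OmniLie.gaugeOp δ v) (A.toJetToGauge_jetAt u m)
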